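/- Let $\mathcal{A}$ be an abelian category, $n\ge 0$, and for $i=1,\dots,n$ let $F_i\colon\mathcal{A}\to\mathcal{A}$ be exact functors which commute with each other, $\eta_i\colon F_i\to\mathrm{id}_{\mathcal{A}}$ natural transformations, and $p_i\ge 2$ integers. Here commuting means that coherent natural isomorphisms $F_jF_i\cong F_iF_j$ are given (mutually inverse for $(i,j)$ and $(j,i)$, the identity for $i=j$, and such that the two induced isomorphisms $F_kF_jF_i\cong F_iF_jF_k$ agree), and that the $\eta_i$ are compatible with them: for $i\neq j$ the morphisms $F_j(\eta_i(X))\colon F_jF_iX\to F_jX$ and $\eta_i(F_jX)\colon F_iF_jX\to F_jX$ coincide under $F_jF_iX\cong F_iF_jX$. Let $S=\{1,\dots,p_1\}\times\dots\times\{1,\dots,p_n\}$, with $\mathbf{e}_i$ the $i$-th basis vector of $\mathbb{Z}^n$. For families of objects or morphisms indexed by $S$ also allow non-positive indices, interpreted by $M_{\mathbf{a}}:=F_iM_{\mathbf{a}+p_i\mathbf{e}_i}$ and similarly for morphisms. Let $\mathcal{A}[\eta_1^{1/p_1},\dots,\eta_n^{1/p_n}]$ be the abelian category whose objects are families $\big((M_{\mathbf{a}})_{\mathbf{a}\in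 S},(f^i_{\mathbf{a}}\colon M_{\mathbf{a}-\mathbf{e}_i}\to M_{\mathbf{a}})_{1\le i\le n,\ \mathbf{a}\in S}\big)$ of objects and morphisms of $\mathcal{A}$ such that for all $i,j$ and all $\mathbf{a}\in S$ the two composites $M_{\mathbf{a}-\mathbf{e}_i-\mathbf{e}_j}\to M_{\mathbf{a}}$ of morphisms $f^i$, $f^j$ agree, and the composite $F_iM_{\mathbf{a}}=M_{\mathbf{a}-p_i\mathbf{e}_i}\to M_{\mathbf{a}-(p_i-1)\mathbf{e}_i}\to\dots\to M_{\mathbf{a}-\mathbf{e}_i}\to M_{\mathbf{a}}$ of morphisms $f^i$ equals $\eta_i(M_{\mathbf{a}})$; its morphisms $(M_{\mathbf{a}},f^i_{\mathbf{a}})\to(N_{\mathbf{a}},g^i_{\mathbf{a}})$ are the families of morphisms $\varphi_{\mathbf{a}}\colon M_{\mathbf{a}}\to N_{\mathbf{a}}$, $\mathbf{a}\in S$, which commute with all $f^i_{\mathbf{a}}$ and $g^i_{\mathbf{a}}$. For $I\subseteq\{1,\dots,n\}$ let $\mathcal{A}_I$ be the full subcategory of $\mathcal{A}$ consisting of all $M$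 with $\eta_i(M)=0$ for all $i\in I$. Assume that for all $I$ and all $i\in\{1,\dots,n\}\setminus I$, every object of $\mathcal{A}_I$ is a quotient of an object $M\in\mathcal{A}_I$ such that $\eta_i(M)$ is a monomorphism. Assume further that all $F_i$ are autoequivalences of $\mathcal{A}$. Then \[ \operatorname{gldim}\mathcal{A}[\eta_1^{1/p_1},\dots,\eta_n^{1/p_n}]=\max_{I\subseteq\{1,\dots,n\}}\big(\operatorname{gldim}\mathcal{A}_I+|I|\big). \] Here $\operatorname{gldim}\mathcal{C}\in\{-\infty,0,1,2,\dots,\infty\}$ is the supremum of all $m\ge 0$ such that $\operatorname{Ext}^m_{\mathcal{C}}(X,Y)\ne 0$ for some objects $X,Y$ (Yoneda $\operatorname{Ext}$); so $\operatorname{gldim}0=-\infty$, and the maximum may equivalently be taken over those $I$ with $\mathcal{A}_I\ne 0$. -/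

import Mathlib

open CategoryTheory CategoryTheory.Limits
open scoped ZeroObject

universe v u

/-- The global dimension of an abelian category: the supremum of the projective dimensions
(defined by the vanishing of Yoneda `Ext`) of its objects. It is `⊥` (that is, `-∞`) exactly
for the zero category, and `⊤` (that is, `∞`) if it is not finite. -/
noncomputable def gldim (C : Type u) [Category.{v} C] [Abelian C] : WithBot ℕ∞ :=
  ⨆ X : C, projectiveDimension X

/-- Exact endofunctors `F i` of an abelian category which commute with each other (up to
coherent natural isomorphisms), with natural transformations `η i : F i ⟶ 𝟭 A` which are
compatible with this commutation. -/
structure CommutingSystem (A : Type u) [Category.{v} A] [Abelian A] (ι : Type) where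
  F : ι → A ⥤ A
  leftExact : ∀ i, PreservesFiniteLimits (F i)
  rightExact : ∀ i, PreservesFiniteColimits (F i)
  /-- the identification of `F j (F i X)` with `F i (F j X)` -/
  comm : ∀ i j, F i ⋙ F j ≅ F j ⋙ F i
  comm_self : ∀ i, comm i i = Iso.refl _
  comm_symm : ∀ i j X, (comm i j).hom.app X ≫ (comm j i).hom.app X = 𝟙 _
  /-- the two ways to identify `F k (F j (F i X))` with `F i (F j (F k X))` agree -/
  comm_coherence : ∀ i j k X,
    (F k).map ((comm i j).hom.app X) ≫ (comm i k).hom.app ((F j).obj X) ≫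
        (F i).map ((comm j k).hom.app X) =
      (comm j k).hom.app ((F i).obj X) ≫ (F j).map ((comm i k).hom.app X) ≫
        (comm i j).hom.app ((F k).obj X)
  η : ∀ i, F i ⟶ 𝟭 A
  /-- `F j (η i X) = η i (F j X)` under the identification of `F j (F i X)` and `F i (F j X)` -/
  η_comm : ∀ i j, i ≠ j → ∀ X,
    (F j).map ((η i).app X) = (comm i j).hom.app X ≫ (η i).app ((F j).obj X)

namespace CommutingSystem

variable {A : Type u} [Category.{v} A] [Abelian A] {ι : Type} (D : CommutingSystem A ι)

instance (i : ι) : PreservesFiniteLimits (D.F i) := D.leftExact i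
instance (i : ι) : PreservesFiniteColimits (D.F i) := D.rightExact i
instance (i : ι) : (D.F i).Additive := Functor.additive_of_preserves_binary_products _

/-! ### The subcategories `A_I` -/

/-- The objects `X` such that `η i X = 0` for all `i ∈ I`. -/
def vanishing (I : Finset ι) : ObjectProperty A := fun X => ∀ i ∈ I, (D.η i).app X = 0

/-- The full subcategory `A_I` of the objects `X` such that `η i X = 0` for all `i ∈ I`. -/
abbrev VanishingSub (I : Finset ι) := (D.vanishing I).FullSubcategory

instance (I : Finset ι) : (D.vanishing I).ContainsZero where
  exists_zero := ⟨0, isZero_zero A, fun _ _ => (isZero_zero A).eq_of_tgt _ _⟩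

instance (I : Finset ι) : (D.vanishing I).IsClosedUnderSubobjects where
  prop_of_mono {X Y} f _ hY i hi := by
    have h := (D.η i).naturality f
    rw [hY i hi, comp_zero] at h
    exact (cancel_mono f).1 (by rw [zero_comp]; exact h.symm)

instance (I : Finset ι) : (D.vanishing I).IsClosedUnderQuotients where
  prop_of_epi {X Y} f _ hX i hi := by
    have h := (D.η i).naturality f
    rw [hX i hi, zero_comp] at h
    exact (cancel_epi ((D.F i).map f)).1 (by rw [comp_zero]; exact h)

instance (I : Finset ι) : (D.vanishing I).IsClosedUnderFiniteProducts where
  isClosedUnderLimitsOfShape J _ :=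
    { limitsOfShape_le := by
        rintro X ⟨h⟩ i hi
        refine h.isLimit.hom_ext fun j => ?_
        have h1 := (D.η i).naturality (h.π.app j)
        rw [h.prop_diag_obj j i hi, comp_zero] at h1
        rw [zero_comp]
        exact h1.symm }

/-- For all `I` and all `i ∉ I` the category `A_I` has enough objects `M` such that `η i M` is a
monomorphism: every object of `A_I` is a quotient of such an object of `A_I`. -/
def EnoughMono : Prop :=
  ∀ (I : Finset ι) (i : ι), i ∉ I → ∀ X : A, D.vanishing I X →
    ∃ (M : A) (q : M ⟶ X), D.vanishing I M ∧ Epi q ∧ Mono ((D.η i).app M)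

/-! ### The category `A[η_1^{1/p_1}, …, η_n^{1/p_n}]` -/

end CommutingSystem

/-- The index set `{1, …, p_1} × ⋯ × {1, …, p_n}`; the value `k : Fin (p i)` stands for the
coordinate `k + 1`. -/
abbrev GridIndex {ι : Type} (p : ι → ℕ) : Type := ∀ i, Fin (p i)

/-- `b = a + e_i`. -/
def GridIndex.Step {ι : Type} {p : ι → ℕ} (i : ι) (a b : GridIndex p) : Prop :=
  (b i).val = (a i).val + 1 ∧ ∀ j, j ≠ i → a j = b j

/-- `a` and `b` agree off `i`, the `i`-th coordinate of `a` is the last one, `p_i`, and that of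
`b` is the first one, `1`; that is, `b = a - (p_i - 1) e_i` and `b - e_i = a - p_i e_i`. -/
def GridIndex.Wrap {ι : Type} {p : ι → ℕ} (i : ι) (a b : GridIndex p) : Prop :=
  (a i).val + 1 = p i ∧ (b i).val = 0 ∧ ∀ j, j ≠ i → a j = b j

namespace CommutingSystem

open GridIndex

variable {A : Type u} [Category.{v} A] [Abelian A] {ι : Type} (D : CommutingSystem A ι)

/-- A grid of objects `M_a` and morphisms `f^i_b : M_{b - e_i} ⟶ M_b`, no commutativity required.
If `b - e_i` is an index, then `f^i_b` is a `step`; if not, then `b_i = 1`, the object `M_{b - e_i}`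
is `F i M_a` with `a = b + (p_i - 1) e_i`, and `f^i_b` is a `wrap`. -/
structure PreGrid (p : ι → ℕ) where
  obj : GridIndex p → A
  step : ∀ {i : ι} {a b : GridIndex p}, Step i a b → (obj a ⟶ obj b)
  wrap : ∀ {i : ι} {a b : GridIndex p}, Wrap i a b → ((D.F i).obj (obj a) ⟶ obj b)

variable {D} {p : ι → ℕ}

/-- `IsPath X i a b u` says that `u : X_a ⟶ X_b` is the composite of the consecutive steps in
direction `i` from `a` to `b = a + k e_i`, for some `k ≥ 0`. -/
inductive IsPath (X : D.PreGrid p) (i : ι) (a : GridIndex p) :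
    ∀ b : GridIndex p, (X.obj a ⟶ X.obj b) → Prop
  | refl : IsPath X i a a (𝟙 _)
  | step {b c : GridIndex p} {u : X.obj a ⟶ X.obj b} (hu : IsPath X i a b u) (h : Step i b c) :
      IsPath X i a c (u ≫ X.step h)

variable (D p)

/-- The objects of `A[η_1^{1/p_1}, …, η_n^{1/p_n}]`: grids such that all squares commute and such
that, for all `i` and `a`, the composite of the `p_i` consecutive morphisms in direction `i` from
`M_{a - p_i e_i} = F i M_a` to `M_a` is `η i M_a`. -/
structure Root extends PreGrid D p where
  step_step : ∀ {i j : ι} {a b c d : GridIndex p} (hab : Step i a b) (hbd : Step j b d)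
    (hac : Step j a c) (hcd : Step i c d), step hab ≫ step hbd = step hac ≫ step hcd
  wrap_step : ∀ {i j : ι} {a b c d : GridIndex p} (hab : Wrap i a b) (hbd : Step j b d)
    (hac : Step j a c) (hcd : Wrap i c d),
    wrap hab ≫ step hbd = (D.F i).map (step hac) ≫ wrap hcd
  wrap_wrap : ∀ {i j : ι} {a b c d : GridIndex p} (hab : Wrap i a b) (hbd : Wrap j b d)
    (hac : Wrap j a c) (hcd : Wrap i c d),
    (D.F j).map (wrap hab) ≫ wrap hbd =
      (D.comm i j).hom.app (obj a) ≫ (D.F i).map (wrap hac) ≫ wrap hcd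
  cycle : ∀ {i : ι} {a b c : GridIndex p} {u : obj a ⟶ obj b} {w : obj c ⟶ obj a},
    IsPath toPreGrid i a b u → ∀ h : Wrap i b c, IsPath toPreGrid i c a w →
    (D.F i).map u ≫ wrap h ≫ w = (D.η i).app (obj a)

variable {D p}

/-- A morphism of grids: morphisms `M_a ⟶ N_a` which commute with the structure morphisms. -/
@[ext]
structure PreGrid.Hom (X Y : D.PreGrid p) where
  app : ∀ a, X.obj a ⟶ Y.obj a
  step : ∀ {i : ι} {a b : GridIndex p} (h : Step i a b),
    X.step h ≫ app b = app a ≫ Y.step h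
  wrap : ∀ {i : ι} {a b : GridIndex p} (h : Wrap i a b),
    X.wrap h ≫ app b = (D.F i).map (app a) ≫ Y.wrap h

instance : Category (D.Root p) where
  Hom X Y := PreGrid.Hom X.toPreGrid Y.toPreGrid
  id X := { app := fun _ => 𝟙 _, step := by simp, wrap := by simp }
  comp f g :=
    { app := fun a => f.app a ≫ g.app a
      step := fun h => by rw [← Category.assoc, f.step, Category.assoc, g.step, Category.assoc]
      wrap := fun h => by
        rw [← Category.assoc, f.wrap, Category.assoc, g.wrap, Functor.map_comp, Category.assoc] }

namespace Root

/-! ### Root categories are abelian -/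

@[ext]
theorem hom_ext {X Y : D.Root p} {f g : X ⟶ Y} (h : ∀ a, f.app a = g.app a) : f = g :=
  PreGrid.Hom.ext (funext h)

@[simp] theorem id_app (X : D.Root p) (a) : PreGrid.Hom.app (𝟙 X) a = 𝟙 _ := rfl
@[simp] theorem comp_app {X Y Z : D.Root p} (f : X ⟶ Y) (g : Y ⟶ Z) (a) :
    (f ≫ g).app a = f.app a ≫ g.app a := rfl

instance (X Y : D.Root p) : Zero (X ⟶ Y) :=
  ⟨{ app := fun _ => 0, step := by simp, wrap := by simp }⟩
instance (X Y : D.Root p) : Add (X ⟶ Y) :=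
  ⟨fun f g => { app := fun a => f.app a + g.app a
                step := fun h => by simp [f.step, g.step]
                wrap := fun h => by simp [f.wrap, g.wrap, Functor.map_add] }⟩
instance (X Y : D.Root p) : Neg (X ⟶ Y) :=
  ⟨fun f => { app := fun a => - f.app a
              step := fun h => by simp [f.step]
              wrap := fun h => by simp [f.wrap, Functor.map_neg] }⟩
instance (X Y : D.Root p) : Sub (X ⟶ Y) :=
  ⟨fun f g => { app := fun a => f.app a - g.app a
                step := fun h => by simp [f.step, g.step]
                wrap := fun h => by simp [f.wrap, g.wrap, Functor.map_sub] }⟩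
instance (X Y : D.Root p) : SMul ℕ (X ⟶ Y) :=
  ⟨fun n f => { app := fun a => n • f.app a
                step := fun h => by simp [f.step]
                wrap := fun h => by simp [f.wrap] }⟩
instance (X Y : D.Root p) : SMul ℤ (X ⟶ Y) :=
  ⟨fun n f => { app := fun a => n • f.app a
                step := fun h => by simp [f.step]
                wrap := fun h => by simp [f.wrap] }⟩

instance (X Y : D.Root p) : AddCommGroup (X ⟶ Y) :=
  Function.Injective.addCommGroup (fun f : X ⟶ Y => f.app) (fun _ _ h => PreGrid.Hom.ext h)
    rfl (fun _ _ => rfl) (fun _ => rfl) (fun _ _ => rfl) (fun _ _ => rfl) (fun _ _ => rfl)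

@[simp] theorem zero_app (X Y : D.Root p) (a) : PreGrid.Hom.app (0 : X ⟶ Y) a = 0 := rfl
@[simp] theorem add_app {X Y : D.Root p} (f g : X ⟶ Y) (a) : (f + g).app a = f.app a + g.app a :=
  rfl

instance : Preadditive (D.Root p) where
  add_comp _ _ _ _ _ _ := by ext; simp
  comp_add _ _ _ _ _ _ := by ext; simp

end Root

theorem IsPath.push {X Y : D.PreGrid p} (f : X.Hom Y) {i : ι} {a b : GridIndex p}
    {u : X.obj a ⟶ X.obj b} (hu : IsPath X i a b u) :
    ∃ u', IsPath Y i a b u' ∧ u ≫ f.app b = f.app a ≫ u' := by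
  induction hu with
  | refl => exact ⟨_, .refl, by simp⟩
  | step hu h ih =>
    obtain ⟨u', h1, h2⟩ := ih
    exact ⟨_, .step h1 h, by rw [Category.assoc, f.step, reassoc_of% h2]⟩

theorem IsPath.unpush {X Y : D.PreGrid p} (f : X.Hom Y) {i : ι} {a b : GridIndex p}
    {u : Y.obj a ⟶ Y.obj b} (hu : IsPath Y i a b u) :
    ∃ u', IsPath X i a b u' ∧ u' ≫ f.app b = f.app a ≫ u := by
  induction hu with
  | refl => exact ⟨_, .refl, by simp⟩
  | step hu h ih =>
    obtain ⟨u', h1, h2⟩ := ih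
    exact ⟨_, .step h1 h, by rw [Category.assoc, f.step, reassoc_of% h2]⟩

/-- A grid with a jointly monomorphic family of morphisms to root objects is a root object. -/
def Root.ofMono {T : Type} (Z : D.PreGrid p) (X : T → D.Root p) (f : ∀ t, Z.Hom (X t).toPreGrid)
    (hf : ∀ a (W : A) (u w : W ⟶ Z.obj a), (∀ t, u ≫ (f t).app a = w ≫ (f t).app a) → u = w) :
    D.Root p where
  toPreGrid := Z
  step_step hab hbd hac hcd := hf _ _ _ _ fun t => by
    simp only [Category.assoc, (f t).step]
    rw [reassoc_of% (f t).step, reassoc_of% (f t).step, (X t).step_step hab hbd hac hcd]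
  wrap_step hab hbd hac hcd := hf _ _ _ _ fun t => by
    simp only [Category.assoc, (f t).step, (f t).wrap]
    rw [reassoc_of% (f t).wrap, (X t).wrap_step hab hbd hac hcd, ← Functor.map_comp_assoc,
      ← Functor.map_comp_assoc, (f t).step]
  wrap_wrap {i j a b c d} hab hbd hac hcd := hf _ _ _ _ fun t => by
    have hn := (D.comm i j).hom.naturality ((f t).app a)
    dsimp at hn
    simp only [Category.assoc, (f t).wrap]
    rw [← Functor.map_comp_assoc, ← Functor.map_comp_assoc, (f t).wrap, (f t).wrap,
      Functor.map_comp_assoc, Functor.map_comp_assoc, (X t).wrap_wrap hab hbd hac hcd,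
      reassoc_of% hn]
  cycle {i a b c u w} hu h hw := hf _ _ _ _ fun t => by
    obtain ⟨u', hu', hu2⟩ := hu.push (f t)
    obtain ⟨w', hw', hw2⟩ := hw.push (f t)
    have hn := (D.η i).naturality ((f t).app a)
    dsimp at hn
    rw [Category.assoc, Category.assoc, hw2, reassoc_of% (f t).wrap, ← Functor.map_comp_assoc, hu2,
      Functor.map_comp_assoc, (X t).cycle hu' h hw', hn]

/-- A grid which is a quotient of a root object is a root object. -/
def Root.ofEpi (Z : D.PreGrid p) (X : D.Root p) (f : X.toPreGrid.Hom Z)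
    (hf : ∀ a, Epi (f.app a)) : D.Root p where
  toPreGrid := Z
  step_step hab hbd hac hcd := by
    rw [← cancel_epi (f.app _), ← reassoc_of% f.step, ← reassoc_of% f.step, ← f.step, ← f.step,
      reassoc_of% X.step_step hab hbd hac hcd]
  wrap_step {i _ _ _ _ _} hab hbd hac hcd := by
    rw [← cancel_epi ((D.F i).map (f.app _)), ← reassoc_of% f.wrap, ← f.step,
      ← Functor.map_comp_assoc, ← f.step, Functor.map_comp_assoc, ← f.wrap,
      reassoc_of% X.wrap_step hab hbd hac hcd]
  wrap_wrap {i j a b c d} hab hbd hac hcd := by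
    have hn := (D.comm i j).hom.naturality (f.app a)
    dsimp at hn
    rw [← cancel_epi ((D.F j).map ((D.F i).map (f.app _))), ← Functor.map_comp_assoc, ← f.wrap,
      Functor.map_comp_assoc, ← f.wrap, reassoc_of% hn, ← Functor.map_comp_assoc, ← f.wrap,
      Functor.map_comp_assoc, ← f.wrap, reassoc_of% X.wrap_wrap hab hbd hac hcd]
  cycle {i a b c u w} hu h hw := by
    obtain ⟨u', hu', hu2⟩ := hu.unpush f
    obtain ⟨w', hw', hw2⟩ := hw.unpush f
    have hn := (D.η i).naturality (f.app a)
    dsimp at hn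
    rw [← cancel_epi ((D.F i).map (f.app _)), ← Functor.map_comp_assoc, ← hu2,
      Functor.map_comp_assoc, ← reassoc_of% f.wrap, ← hw2, hn, ← X.cycle hu' h hw']
    simp only [Category.assoc]

namespace Root

/-- The zero grid. -/
noncomputable def zeroObj : D.Root p :=
  ofMono (T := Empty) { obj := fun _ => 0, step := fun _ => 0, wrap := fun _ => 0 }
    (fun t => t.elim) (fun t => t.elim) (fun _ _ _ _ _ => (isZero_zero A).eq_of_tgt _ _)

instance : HasZeroObject (D.Root p) where
  zero := ⟨zeroObj, by
    rw [IsZero.iff_id_eq_zero]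
    exact hom_ext fun _ => (isZero_zero A).eq_of_tgt _ _⟩

/-- The componentwise direct sum. -/
noncomputable def sum (X Y : D.Root p) : D.Root p :=
  ofMono (T := Bool)
    { obj := fun a => X.obj a ⊞ Y.obj a
      step := fun h => biprod.map (X.step h) (Y.step h)
      wrap := fun {i _ _} h => biprod.lift ((D.F i).map biprod.fst ≫ X.wrap h)
        ((D.F i).map biprod.snd ≫ Y.wrap h) }
    (fun t => cond t X Y)
    (fun t => match t with
      | true => { app := fun _ => biprod.fst, step := by simp, wrap := by simp }
      | false => { app := fun _ => biprod.snd, step := by simp, wrap := by simp })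
    (fun _ _ _ _ h => biprod.hom_ext _ _ (h true) (h false))

noncomputable def sumFst (X Y : D.Root p) : sum X Y ⟶ X :=
  { app := fun _ => biprod.fst
    step := fun _ => biprod.map_fst _ _
    wrap := fun _ => biprod.lift_fst _ _ }

noncomputable def sumSnd (X Y : D.Root p) : sum X Y ⟶ Y :=
  { app := fun _ => biprod.snd
    step := fun _ => biprod.map_snd _ _
    wrap := fun _ => biprod.lift_snd _ _ }

noncomputable def sumLift {X Y Z : D.Root p} (f : Z ⟶ X) (g : Z ⟶ Y) : Z ⟶ sum X Y :=
  { app := fun a => biprod.lift (f.app a) (g.app a)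
    step := fun h => by
      dsimp [sum, ofMono]
      ext <;> simp [f.step, g.step]
    wrap := fun h => by
      dsimp [sum, ofMono]
      ext <;> simp [f.wrap, g.wrap, ← Functor.map_comp_assoc] }

instance : HasBinaryProducts (D.Root p) :=
  have (X Y : D.Root p) : HasLimit (pair X Y) :=
    ⟨⟨⟨BinaryFan.mk (sumFst X Y) (sumSnd X Y), BinaryFan.IsLimit.mk _
      (fun f g => sumLift f g) (fun _ _ => hom_ext fun _ => biprod.lift_fst _ _)
      (fun _ _ => hom_ext fun _ => biprod.lift_snd _ _)
      (fun _ _ _ h1 h2 => hom_ext fun a => biprod.hom_ext _ _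
        ((congrArg (fun k => PreGrid.Hom.app k a) h1).trans (biprod.lift_fst _ _).symm)
        ((congrArg (fun k => PreGrid.Hom.app k a) h2).trans (biprod.lift_snd _ _).symm))⟩⟩⟩
  hasBinaryProducts_of_hasLimit_pair _

instance : HasFiniteProducts (D.Root p) := hasFiniteProducts_of_has_binary_and_terminal

section Ker

variable {X Y : D.Root p} (f : X ⟶ Y)

/-- The componentwise kernel. -/
noncomputable def ker : D.Root p :=
  ofMono (T := Unit)
    { obj := fun a => kernel (f.app a)
      step := fun {_ a b} h => kernel.lift _ (kernel.ι (f.app a) ≫ X.step h) (by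
        rw [Category.assoc, f.step, kernel.condition_assoc, zero_comp])
      wrap := fun {i a b} h => kernel.lift _ ((D.F i).map (kernel.ι (f.app a)) ≫ X.wrap h) (by
        rw [Category.assoc, f.wrap, ← Functor.map_comp_assoc, kernel.condition, Functor.map_zero,
          zero_comp]) }
    (fun _ => X)
    (fun _ => { app := fun a => kernel.ι (f.app a), step := by simp, wrap := by simp })
    (fun _ _ _ _ h => (cancel_mono (kernel.ι _)).1 (h ()))

noncomputable def kerι : ker f ⟶ X :=
  { app := fun a => kernel.ι (f.app a)
    step := fun _ => kernel.lift_ι _ _ _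
    wrap := fun _ => kernel.lift_ι _ _ _ }

instance (a : GridIndex p) : Mono ((kerι f).app a) := inferInstanceAs (Mono (kernel.ι (f.app a)))

theorem kerι_comp : kerι f ≫ f = 0 := hom_ext fun _ => kernel.condition _

noncomputable def wrapCoker {i : ι} {a b : GridIndex p} (h : Wrap i a b) :
    (D.F i).obj (cokernel (f.app a)) ⟶ cokernel (f.app b) :=
  (PreservesCokernel.iso (D.F i) (f.app a)).hom ≫
    cokernel.desc _ (Y.wrap h ≫ cokernel.π (f.app b)) (by
      rw [← Category.assoc, ← f.wrap, Category.assoc, cokernel.condition, comp_zero])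

theorem map_π_wrapCoker {i : ι} {a b : GridIndex p} (h : Wrap i a b) :
    (D.F i).map (cokernel.π (f.app a)) ≫ wrapCoker f h = Y.wrap h ≫ cokernel.π (f.app b) := by
  simp [wrapCoker]

/-- The componentwise cokernel. -/
noncomputable def coker : D.Root p :=
  ofEpi
    { obj := fun a => cokernel (f.app a)
      step := fun {_ a b} h => cokernel.desc _ (Y.step h ≫ cokernel.π (f.app b)) (by
        rw [← Category.assoc, ← f.step, Category.assoc, cokernel.condition, comp_zero])
      wrap := fun h => wrapCoker f h }
    Y
    { app := fun a => cokernel.π (f.app a)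
      step := by simp
      wrap := fun h => (map_π_wrapCoker f h).symm }
    (fun _ => inferInstance)

noncomputable def cokerπ : Y ⟶ coker f :=
  { app := fun a => cokernel.π (f.app a)
    step := fun _ => (cokernel.π_desc _ _ _).symm
    wrap := fun h => (map_π_wrapCoker f h).symm }

instance (a : GridIndex p) : Epi ((cokerπ f).app a) :=
  inferInstanceAs (Epi (cokernel.π (f.app a)))

theorem comp_cokerπ : f ≫ cokerπ f = 0 := hom_ext fun _ => cokernel.condition _

/-- A componentwise monomorphism `g` is a kernel of `f` if it is one componentwise. -/
noncomputable def isKernel {W : D.Root p} (g : W ⟶ X) (w : g ≫ f = 0) (hg : ∀ a, Mono (g.app a))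
    (lift : ∀ a {Z : A} (k : Z ⟶ X.obj a), k ≫ f.app a = 0 → (Z ⟶ W.obj a))
    (hlift : ∀ a {Z : A} (k : Z ⟶ X.obj a) (hk : k ≫ f.app a = 0), lift a k hk ≫ g.app a = k) :
    IsLimit (KernelFork.ofι g w) :=
  KernelFork.IsLimit.ofι _ _
    (fun k hk =>
      { app := fun a => lift a (k.app a) (congrArg (fun k => PreGrid.Hom.app k a) hk)
        step := fun h => by
          rw [← cancel_mono (g.app _), Category.assoc, Category.assoc, hlift, g.step,
            ← Category.assoc (lift _ _ _), hlift, k.step]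
        wrap := fun h => by
          rw [← cancel_mono (g.app _), Category.assoc, Category.assoc, hlift, g.wrap,
            ← Functor.map_comp_assoc, hlift, k.wrap] })
    (fun k hk => hom_ext fun a => hlift _ _ _)
    (fun k hk m hm => hom_ext fun a => (cancel_mono (g.app a)).1 (by
      rw [hlift]; exact congrArg (fun k => PreGrid.Hom.app k a) hm))

/-- A componentwise epimorphism `g` is a cokernel of `f` if it is one componentwise. -/
noncomputable def isCokernel {W : D.Root p} (g : Y ⟶ W) (w : f ≫ g = 0) (hg : ∀ a, Epi (g.app a))
    (desc : ∀ a {Z : A} (k : Y.obj a ⟶ Z), f.app a ≫ k = 0 → (W.obj a ⟶ Z))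
    (hdesc : ∀ a {Z : A} (k : Y.obj a ⟶ Z) (hk : f.app a ≫ k = 0), g.app a ≫ desc a k hk = k) :
    IsColimit (CokernelCofork.ofπ g w) :=
  CokernelCofork.IsColimit.ofπ _ _
    (fun k hk =>
      { app := fun a => desc a (k.app a) (congrArg (fun k => PreGrid.Hom.app k a) hk)
        step := fun h => by
          rw [← cancel_epi (g.app _), ← reassoc_of% g.step, hdesc, ← Category.assoc (g.app _),
            hdesc, k.step]
        wrap := fun {i _ _} h => by
          rw [← cancel_epi ((D.F i).map (g.app _)), ← reassoc_of% g.wrap, hdesc,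
            ← Functor.map_comp_assoc, hdesc, k.wrap] })
    (fun k hk => hom_ext fun a => hdesc _ _ _)
    (fun k hk m hm => hom_ext fun a => (cancel_epi (g.app a)).1 (by
      rw [hdesc]; exact congrArg (fun k => PreGrid.Hom.app k a) hm))

theorem mono_app [Mono f] (a : GridIndex p) : Mono (f.app a) := by
  have h : kerι f = 0 := (cancel_mono f).1 (by rw [kerι_comp, zero_comp])
  exact Preadditive.mono_of_kernel_zero (congrArg (fun k => PreGrid.Hom.app k a) h)

theorem epi_app [Epi f] (a : GridIndex p) : Epi (f.app a) := by
  have h : cokerπ f = 0 := (cancel_epi f).1 (by rw [comp_cokerπ, comp_zero])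
  exact Preadditive.epi_of_cokernel_zero (congrArg (fun k => PreGrid.Hom.app k a) h)

end Ker

instance : HasKernels (D.Root p) where
  has_limit f := ⟨⟨⟨_, isKernel f (kerι f) (kerι_comp f) (fun _ => inferInstance)
    (fun _ _ k hk => kernel.lift _ k hk) (fun _ _ _ _ => kernel.lift_ι _ _ _)⟩⟩⟩

instance : HasCokernels (D.Root p) where
  has_colimit f := ⟨⟨⟨_, isCokernel f (cokerπ f) (comp_cokerπ f) (fun _ => inferInstance)
    (fun _ _ k hk => cokernel.desc _ k hk) (fun _ _ _ _ => cokernel.π_desc _ _ _)⟩⟩⟩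

instance : IsNormalMonoCategory (D.Root p) where
  normalMonoOfMono f _ := ⟨
    { Z := coker f
      g := cokerπ f
      w := comp_cokerπ f
      isLimit :=
        have := mono_app f
        isKernel (cokerπ f) f (comp_cokerπ f) this
          (fun a _ k hk => Abelian.monoLift (f.app a) k hk)
          (fun a _ k hk => Abelian.monoLift_comp (f.app a) k hk) }⟩

instance : IsNormalEpiCategory (D.Root p) where
  normalEpiOfEpi f _ := ⟨
    { W := ker f
      g := kerι f
      w := kerι_comp f
      isColimit :=
        have := epi_app f
        isCokernel (kerι f) f (kerι_comp f) this
          (fun a _ k hk => Abelian.epiDesc (f.app a) k hk)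
          (fun a _ k hk => Abelian.comp_epiDesc (f.app a) k hk) }⟩

noncomputable instance : Abelian (D.Root p) where

end Root

end CommutingSystem

/-! The proof is an induction on the number of functors, resting on a theorem in one variable.

One variable. Let `η : F ⟶ 𝟭 C`, and let `C'` be the zero locus of `η`. For diagrams `M_0 ⟶ ⋯ ⟶ M_m`
closed up by `F M_m ⟶ M_0`, with `m ≥ 1`, the global dimension is `max (gldim C) (gldim C' + 1)`.
Two kinds of diagrams generate everything. Constant diagrams come with exact adjunctions `ev_last ⊣
const ⊣ ev_0`, so `Ext` into or out of them is `Ext` in `C`. Skyscrapers `sky k Y`, with `Y` in `C'`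
placed in degree `k + 1`, are right adjoint to `M ↦ coker (M_k ⟶ M_{k+1})`; this functor is exact on
diagrams for which `M_k ⟶ M_{k+1}` is mono.

Upper bound: the counit `const X_0 ⟶ X` is an isomorphism in degree `0`, and what vanishes there is
an iterated extension of skyscrapers. `Ext(M, const Y)` is controlled by `C`. `Ext(M, sky Y)` is
controlled by `C'` after one dimension shift along a cover of `M` with `M_k ⟶ M_{k+1}` mono; this
shift is the `+ 1`. Lower bound: `const` is fully faithful with exact right adjoint, and the
inclusion of the top skyscraper of `X` into `const X` turns `Ext^i` in `C'` into `Ext^{i+1}` of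
diagrams.

No enough projectives are available. `Ext` is compared across adjunctions by dimension shifting
(`Adjunction.extMap_bijective`), which only needs that Yoneda classes of positive degree die on some
epimorphism (`Ext.exists_epi_mk₀_comp_eq_zero`).

Induction. Slicing along the first coordinate (`unslice`) identifies a root category with
one-variable diagrams over the root category of the other functors, with `F 0` and `η 0` applied
componentwise. Its zero locus is the root category of the other functors restricted to the objects
killed by `η 0`. The two terms of the maximum thus account for the subsets `I` without and with `0`.
Everything is phrased through the bounds `GlobalDimensionLT _ N`, which determine `gldim`. -/

set_option linter.unusedSectionVars false

/-! ### Positive-degree `Ext` classes are effaced by epimorphisms -/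

section Effaceability

open Abelian DerivedCategory

universe w

variable {C : Type u} [Category.{v} C] [Abelian C]

/-- As `K.X 1 = 0`, everything in degree `0` is a cycle, and the map is the composite `K.X 0 = Z^0 ⟶
H^0(K) ≅ X`. -/
lemma HomologicalComplex.epi_f_zero_of_quasiIsoAt {K : CochainComplex C ℤ} {X : C}
    (s : K ⟶ (HomologicalComplex.single C (ComplexShape.up ℤ) 0).obj X) [QuasiIsoAt s 0]
    (hK : IsZero (K.X 1)) : Epi (s.f 0 ≫ (singleObjXSelf (ComplexShape.up ℤ) 0 X).hom) := by
  let e := K.iCyclesIso 0 1 (by simp) (hK.eq_of_tgt _ _)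
  have h : s.f 0 ≫ (singleObjXSelf (ComplexShape.up ℤ) 0 X).hom = e.inv ≫ K.homologyπ 0 ≫
      homologyMap s 0 ≫ (singleObjHomologySelfIso _ _ _).hom := by
    rw [← cancel_epi e.hom, Iso.hom_inv_id_assoc, homologyπ_naturality_assoc,
      homologyπ_singleObjHomologySelfIso_hom,
      ← cancel_mono (singleObjXSelf (ComplexShape.up ℤ) 0 X).inv]
    simp only [Category.assoc, Iso.hom_inv_id, Category.comp_id]
    rw [← singleObjCyclesSelfIso_inv_iCycles, Iso.hom_inv_id_assoc]
    exact (cyclesMap_i s 0).symm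
  rw [h]
  infer_instance

lemma HomologicalComplex.mkHomFromSingle_comp_f {K : CochainComplex C ℤ} {X : C}
    (s : K ⟶ (HomologicalComplex.single C (ComplexShape.up ℤ) 0).obj X)
    (h : ∀ k, (ComplexShape.up ℤ).Rel 0 k → 𝟙 (K.X 0) ≫ K.d 0 k = 0) :
    (mkHomFromSingle (𝟙 (K.X 0)) h ≫ s).f 0 =
      ((HomologicalComplex.single C (ComplexShape.up ℤ) 0).map
        (s.f 0 ≫ (singleObjXSelf (ComplexShape.up ℤ) 0 X).hom)).f 0 := by
  rw [comp_f, mkHomFromSingle_f, single_map_f_self]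
  simp

/-- Write `φ` as a roof `X ⟵ K ⟶ L` with `K` concentrated in degrees `≤ 0`. Then `K.X 0 ⟶ X` is epi,
and restricting the roof to `K.X 0` in degree `0` gives a chain map into `L`, which is zero because
`L` vanishes in degree `0`. -/
lemma exists_epi_Q_map_comp_eq_zero [HasDerivedCategory.{w} C] {X : C} {L : CochainComplex C ℤ}
    (φ : Q.obj ((CochainComplex.singleFunctor C 0).obj X) ⟶ Q.obj L) (n : ℤ) (hn : n < 0)
    [L.IsStrictlyLE n] :
    ∃ (X' : C) (q : X' ⟶ X), Epi q ∧
      Q.map ((CochainComplex.singleFunctor C 0).map q) ≫ φ = 0 := by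
  obtain ⟨K, _, s, hs, g, rfl⟩ := right_fac_of_isStrictlyLE φ 0
  rw [isIso_Q_map_iff_quasiIso] at hs
  let q : K.X 0 ⟶ X := s.f 0 ≫ (HomologicalComplex.singleObjXSelf (ComplexShape.up ℤ) 0 X).hom
  let ι : (CochainComplex.singleFunctor C 0).obj (K.X 0) ⟶ K :=
    HomologicalComplex.mkHomFromSingle (𝟙 _) (by
      rintro _ rfl
      apply (K.isZero_of_isStrictlyLE 0 _ (by simp)).eq_of_tgt)
  have hι : ι ≫ s = (CochainComplex.singleFunctor C 0).map q := by
    apply HomologicalComplex.from_single_hom_ext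
    exact HomologicalComplex.mkHomFromSingle_comp_f s _
  have hg : ι ≫ g = 0 := by
    apply HomologicalComplex.from_single_hom_ext
    apply (L.isZero_of_isStrictlyLE n 0 hn).eq_of_tgt
  refine ⟨K.X 0, q, ?_, ?_⟩
  · have : QuasiIsoAt
      (L := (HomologicalComplex.single C (ComplexShape.up ℤ) 0).obj X) s 0 := hs.quasiIsoAt 0
    exact HomologicalComplex.epi_f_zero_of_quasiIsoAt s (K.isZero_of_isStrictlyLE 0 1 (by simp))
  · rw [← hι, Q.map_comp, Category.assoc, IsIso.hom_inv_id_assoc, ← Q.map_comp, hg, Q.map_zero]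

lemma CategoryTheory.Abelian.Ext.exists_epi_mk₀_comp_eq_zero [HasExt.{w} C] {X Y : C} {n : ℕ}
    (e : Ext X Y (n + 1)) :
    ∃ (X' : C) (q : X' ⟶ X), Epi q ∧ (Ext.mk₀ q).comp e (zero_add _) = 0 := by
  let := HasDerivedCategory.standard C
  obtain ⟨X', q, hq, h⟩ := exists_epi_Q_map_comp_eq_zero
    (L := (CochainComplex.singleFunctor C (-(n + 1))).obj Y) (X := X)
    (e.hom ≫ ((singleFunctors C).shiftIso (n + 1) (-(n + 1)) 0 (by lia)).hom.app _)
    (-(n + 1)) (by lia)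
  refine ⟨X', q, hq, Ext.homEquiv.injective ?_⟩
  simp only [← cancel_mono (((singleFunctors C).shiftIso (n + 1) (-(n + 1)) 0
    (by lia)).hom.app _), Ext.zero_hom, Limits.zero_comp]
  refine Eq.trans ?_ h
  change ((Ext.mk₀ q).comp e _).hom ≫ _ = _
  rw [Ext.comp_hom, Ext.mk₀_hom, ShiftedHom.mk₀_comp, Category.assoc]
  rfl

end Effaceability

/-! ### Comparing `Ext` across an adjunction -/

section Adjunction

open Abelian

universe v₁ u₁ v₂ u₂ w₁ w₂

variable {B : Type u₁} [Category.{v₁} B] [Abelian B] {C : Type u₂} [Category.{v₂} C] [Abelian C]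
  [HasExt.{w₁} B] [HasExt.{w₂} C]

/-- The map `Ext C (L M) Y n → Ext B M (R Y) n` induced by an adjunction `L ⊣ R` with `R` exact. -/
noncomputable def CategoryTheory.Adjunction.extMap {L : B ⥤ C} {R : C ⥤ B} (adj : L ⊣ R)
    [R.Additive] [PreservesFiniteLimits R] [PreservesFiniteColimits R] (M : B) (Y : C) (n : ℕ)
    (e : Ext (L.obj M) Y n) : Ext M (R.obj Y) n :=
  (Ext.mk₀ (adj.unit.app M)).comp (e.mapExactFunctor R) (zero_add n)

namespace CategoryTheory.Adjunction

variable {L : B ⥤ C} {R : C ⥤ B} (adj : L ⊣ R)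
  [R.Additive] [PreservesFiniteLimits R] [PreservesFiniteColimits R]

lemma extMap_zero (M : B) (Y : C) (n : ℕ) : adj.extMap M Y n 0 = 0 := by
  simp [extMap]

lemma extMap_sub (M : B) (Y : C) (n : ℕ) (e e' : Ext (L.obj M) Y n) :
    adj.extMap M Y n (e - e') = adj.extMap M Y n e - adj.extMap M Y n e' := by
  have h : (e - e').mapExactFunctor R = e.mapExactFunctor R - e'.mapExactFunctor R :=
    map_sub (R.mapExtAddHom _ _ _) e e'
  rw [extMap, h, sub_eq_add_neg, Ext.comp_add, Ext.comp_neg, ← sub_eq_add_neg]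
  rfl

lemma extMap_naturality {M N : B} (f : M ⟶ N) (Y : C) (n : ℕ) (e : Ext (L.obj N) Y n) :
    adj.extMap M Y n ((Ext.mk₀ (L.map f)).comp e (zero_add n)) =
      (Ext.mk₀ f).comp (adj.extMap N Y n e) (zero_add n) := by
  simp [extMap, Ext.mapExactFunctor_comp, Ext.mapExactFunctor_mk₀]

/-- The unit is a morphism from `S` to its image under `R L`, so connecting classes correspond. This
compatibility drives the dimension shift. -/
lemma extMap_extClass_comp [L.Additive] {S : ShortComplex B} (hS : S.ShortExact)
    (hS' : (ShortComplex.mk (L.map S.f) (L.map S.g)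
      (by rw [← L.map_comp, S.zero, L.map_zero])).ShortExact)
    (Y : C) {n n' : ℕ} (h : 1 + n = n') (e : Ext (L.obj S.X₁) Y n) :
    adj.extMap S.X₃ Y n' (hS'.extClass.comp e h) =
      hS.extClass.comp (adj.extMap S.X₁ Y n e) h := by
  have hS'' : (ShortComplex.mk (R.map (L.map S.f)) (R.map (L.map S.g))
      (by rw [← R.map_comp, ← L.map_comp, S.zero, L.map_zero, R.map_zero])).ShortExact :=
    hS'.map_of_exact R
  have hR : hS'.extClass.mapExactFunctor R = hS''.extClass := Ext.mapExactFunctor_extClass R hS'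
  have hn := ShortComplex.ShortExact.extClass_naturality hS hS''
    (ShortComplex.homMk (adj.unit.app S.X₁) (adj.unit.app S.X₂) (adj.unit.app S.X₃)
      (adj.unit.naturality S.f).symm (adj.unit.naturality S.g).symm)
  dsimp only [extMap]
  rw [Ext.mapExactFunctor_comp, hR,
    ← Ext.comp_assoc (a₁₂ := 1) _ _ _ (by lia) (by lia) (by lia),
    ← Ext.comp_assoc (a₁₂ := 1) _ _ _ (by lia) (by lia) (by lia)]
  exact congrArg (fun x => Ext.comp x _ h) hn.symm

lemma extMap_zero_bijective (M : B) (Y : C) : Function.Bijective (adj.extMap M Y 0) := by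
  have h : adj.extMap M Y 0 = Ext.homEquiv₀.symm ∘ adj.homEquiv M Y ∘ Ext.homEquiv₀ := by
    ext e
    obtain ⟨f, rfl⟩ := (Ext.mk₀_bijective _ _).2 e
    simp [extMap, Ext.mapExactFunctor_mk₀, Ext.homEquiv₀, adj.homEquiv_unit]
  rw [h]
  exact Ext.homEquiv₀.symm.bijective.comp
    ((adj.homEquiv M Y).bijective.comp Ext.homEquiv₀.bijective)

/-- Let `L ⊣ R` with `R` exact, and let `P` be a class of objects closed under subobjects, such
that every object is a quotient of an object in `P`, and such that `L` is exact on `P`. Then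
`Ext (L M) Y n` and `Ext M (R Y) n` agree if `M` is in `P`. -/
theorem extMap_bijective [L.Additive] (P : ObjectProperty B) [P.IsClosedUnderSubobjects]
    (hP : ∀ X : B, ∃ (M : B) (q : M ⟶ X), P M ∧ Epi q)
    (hL : ∀ S : ShortComplex B, S.ShortExact → P S.X₂ → P S.X₃ → (S.map L).ShortExact)
    (Y : C) (n : ℕ) (M : B) (hM : P M) : Function.Bijective (adj.extMap M Y n) := by
  -- The covering sequence `S` ends in `M` only up to an equation, so that matching on `rfl` later
  -- replaces `M` by `S.X₃`. The kernel `S.X₁` is in `P` by closure under subobjects, so the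
  -- induction hypothesis applies to it.
  have key (M : B) (hM : P M) (K : B) (r : K ⟶ M) [Epi r] :
      ∃ (S : ShortComplex B) (_ : S.ShortExact) 
        (_ : (ShortComplex.mk (L.map S.f) (L.map S.g)
          (by rw [← L.map_comp, S.zero, L.map_zero])).ShortExact)
        (_ : P S.X₁)
        (_ : P S.X₂) (e : S.X₃ = M) (g : S.X₂ ⟶ K), g ≫ r = S.g ≫ eqToHom e := by
    obtain ⟨M', q, hM', hq⟩ := hP K
    have hS : (ShortComplex.mk (kernel.ι (q ≫ r)) (q ≫ r) (kernel.condition _)).ShortExact :=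
      { exact := ShortComplex.exact_kernel _ }
    exact ⟨_, hS, hL _ hS hM' hM, P.prop_of_mono (kernel.ι (q ≫ r)) hM', hM', rfl, q, by simp⟩
  induction n generalizing M with
  | zero => exact adj.extMap_zero_bijective M Y
  | succ n ih =>
    constructor
    · suffices ∀ e, adj.extMap M Y (n + 1) e = 0 → e = 0 by
        intro e e' h
        rw [← sub_eq_zero]
        exact this _ (by rw [extMap_sub, h, sub_self])
      intro e he
      obtain ⟨X', q, hq, hqe⟩ := e.exists_epi_mk₀_comp_eq_zero
      -- Pulling `R q` back along the unit gives an epimorphism onto `M`. Over any cover factoring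
      -- through it, `L S.g` factors through `q` by adjunction, hence kills `e`.
      obtain ⟨S, hS, hS', h1, h2, rfl, g, hg⟩ :=
        key M hM (pullback (adj.unit.app M) (R.map q)) (pullback.fst _ _)
      obtain ⟨e', rfl⟩ := Ext.contravariant_sequence_exact₃ hS' _ e (by
        have : L.map S.g = (adj.homEquiv _ _).symm (g ≫ pullback.snd _ _) ≫ q := by
          apply (adj.homEquiv _ _).injective
          rw [adj.homEquiv_naturality_right, Equiv.apply_symm_apply, Category.assoc,
            ← pullback.condition, reassoc_of% hg, adj.homEquiv_unit]
          simp
        refine Eq.trans (congrArg (fun x => (Ext.mk₀ x).comp e (zero_add _)) this) ?_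
        rw [← Ext.mk₀_comp_mk₀_assoc, hqe, Ext.comp_zero]) (add_comm 1 n)
      -- The image of `e'` has zero connecting class, so it is restricted from `S.X₂`. Surjectivity
      -- in degree `n` for `S.X₂` and injectivity for `S.X₁` carry this back to `e'`, whence `e =
      -- 0`.
      obtain ⟨f, hf⟩ := Ext.contravariant_sequence_exact₁ hS _ _ (add_comm 1 n)
        ((adj.extMap_extClass_comp hS hS' Y (add_comm 1 n) e').symm.trans he)
      obtain ⟨f', rfl⟩ := (ih _ h2).2 f
      rw [← extMap_naturality] at hf
      rw [← (ih _ h1).1 hf]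
      exact hS'.extClass_comp_assoc f'
    · intro e
      obtain ⟨X', q, hq, hqe⟩ := e.exists_epi_mk₀_comp_eq_zero
      obtain ⟨S, hS, hS', h1, h2, rfl, g, hg⟩ := key M hM X' q
      obtain ⟨e', rfl⟩ := Ext.contravariant_sequence_exact₃ hS _ e (by
        rw [eqToHom_refl, Category.comp_id] at hg
        rw [← hg, ← Ext.mk₀_comp_mk₀_assoc, hqe, Ext.comp_zero]) (add_comm 1 n)
      obtain ⟨e'', rfl⟩ := (ih _ h1).2 e'
      exact ⟨_, adj.extMap_extClass_comp hS hS' Y (add_comm 1 n) e''⟩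

/-- For an adjunction `L ⊣ R` of exact functors, `Ext (L M) Y n` and `Ext M (R Y) n` agree. -/
theorem extMap_bijective_of_exact [L.Additive] [PreservesFiniteLimits L]
    [PreservesFiniteColimits L] (Y : C) (n : ℕ) (M : B) :
    Function.Bijective (adj.extMap M Y n) :=
  adj.extMap_bijective ⊤ (fun X => ⟨X, 𝟙 X, trivial, inferInstance⟩)
    (fun _ hS _ _ => hS.map_of_exact L) Y n M trivial

end CategoryTheory.Adjunction

end Adjunction

/-! ### Global dimension through its strict natural upper bounds -/

section GlobalDimension

open Abelian

universe w v₁ u₁ v₂ u₂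

/-- All objects have projective dimension less than `N`. -/
def GlobalDimensionLT (C : Type u) [Category.{v} C] [Abelian C] (N : ℕ) : Prop :=
  ∀ X : C, HasProjectiveDimensionLT X N

variable {C : Type u₂} [Category.{v₂} C] [Abelian C]

lemma gldim_lt_iff (N : ℕ) : gldim C < N ↔ GlobalDimensionLT C N := by
  simp only [GlobalDimensionLT, ← projectiveDimension_lt_iff]
  refine ⟨fun h X => (le_iSup (fun X : C => projectiveDimension X) X).trans_lt h, fun h => ?_⟩
  cases N with
  | zero =>
    have : gldim C ≤ ⊥ := iSup_le fun X => by
      have := h X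
      rw [projectiveDimension_lt_iff, hasProjectiveDimensionLT_zero_iff_isZero,
        ← projectiveDimension_eq_bot_iff] at this
      exact this.le
    exact this.trans_lt (WithBot.bot_lt_coe _)
  | succ N =>
    have : gldim C ≤ N := iSup_le fun X => by
      rw [projectiveDimension_le_iff]
      exact projectiveDimension_lt_iff.1 (h X)
    exact this.trans_lt (by norm_cast; exact Nat.lt_succ_self N)

lemma globalDimensionLT_iff [HasExt.{w} C] (N : ℕ) : GlobalDimensionLT C N ↔
    ∀ (X Y : C) (i : ℕ), N ≤ i → ∀ e : Ext.{w} X Y i, e = 0 :=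
  ⟨fun h X _ _ hi e => have := h X; e.eq_zero_of_hasProjectiveDimensionLT N hi,
    fun h X => HasProjectiveDimensionLT.mk fun i hi _ => h X _ i hi⟩

lemma withBot_enat_cases (x : WithBot ℕ∞) : x = ⊥ ∨ x = ⊤ ∨ ∃ n : ℕ, x = n := by
  induction x using WithBot.recBotCoe with
  | bot => exact Or.inl rfl
  | coe x =>
    induction x using ENat.recTopCoe with
    | top => exact Or.inr (Or.inl rfl)
    | coe n => exact Or.inr (Or.inr ⟨n, rfl⟩)

lemma withBot_enat_not_top_lt (n : ℕ) : ¬ (⊤ : WithBot ℕ∞) < n := not_top_lt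

/-- A value in `{-∞, 0, 1, …, ∞}` is determined by the natural numbers strictly above it; `0` lies
above `-∞` only. -/
lemma withBot_enat_eq_of_lt_iff {x y : WithBot ℕ∞} (h : ∀ N : ℕ, x < N ↔ y < N) : x = y := by
  obtain rfl | rfl | ⟨m, rfl⟩ := withBot_enat_cases x <;>
    obtain rfl | rfl | ⟨n, rfl⟩ := withBot_enat_cases y
  · rfl
  · simpa using h 0
  · simpa using h n
  · simpa using h 0
  · rfl
  · have := (h (n + 1)).2 (by norm_cast; exact Nat.lt_succ_self n)
    exact absurd this (withBot_enat_not_top_lt _)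
  · simpa using h m
  · have := (h (m + 1)).1 (by norm_cast; exact Nat.lt_succ_self m)
    exact absurd this (withBot_enat_not_top_lt _)
  · have h1 := h m
    have h2 := h n
    norm_cast at h1 h2 ⊢
    omega

/-- Truncated subtraction is correct here: for `N ≤ k` both sides hold exactly when `x = -∞`. -/
lemma withBot_enat_add_lt_iff (x : WithBot ℕ∞) (k N : ℕ) :
    x + (k : WithBot ℕ∞) < N ↔ x < (N - k : ℕ) := by
  obtain rfl | rfl | ⟨m, rfl⟩ := withBot_enat_cases x
  · simp
  · have : (⊤ : WithBot ℕ∞) + (k : WithBot ℕ∞) = ⊤ := rfl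
    simp only [this, withBot_enat_not_top_lt]
  · norm_cast
    omega

variable {B : Type u₁} [Category.{v₁} B] [Abelian B]

/-- If `L ⊣ R` is an adjunction of exact functors with `L` fully faithful, then the global
dimension of the source of `L` is at most that of its target. -/
lemma GlobalDimensionLT.of_adjunction {L : B ⥤ C} {R : C ⥤ B} (adj : L ⊣ R) [L.Full] [L.Faithful]
    [PreservesFiniteLimits L] [PreservesFiniteColimits L] [PreservesFiniteLimits R]
    [PreservesFiniteColimits R] {N : ℕ} (h : GlobalDimensionLT C N) : GlobalDimensionLT B N := by
  let := HasExt.standard B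
  let := HasExt.standard C
  have : L.Additive := Functor.additive_of_preserves_binary_products _
  have : R.Additive := Functor.additive_of_preserves_binary_products _
  rw [globalDimensionLT_iff] at h ⊢
  intro X Y i hi e
  -- `L` is fully faithful, so `Y ≅ R (L Y)` by the unit, and `e` becomes a class coming from `Ext
  -- (L X) (L Y)`.
  obtain ⟨e', he'⟩ := (adj.extMap_bijective_of_exact (L.obj Y) i X).2
    (e.comp (Ext.mk₀ (adj.unit.app Y)) (add_zero i))
  rw [h _ _ i hi e', adj.extMap_zero] at he'
  have : (e.comp (Ext.mk₀ (adj.unit.app Y)) (add_zero i)).comp (Ext.mk₀ (inv (adj.unit.app Y)))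
      (add_zero i) = e := by
    simp
  rw [← this, ← he', Ext.zero_comp]

lemma globalDimensionLT_iff_of_equivalence (e : B ≌ C) (N : ℕ) :
    GlobalDimensionLT B N ↔ GlobalDimensionLT C N :=
  ⟨GlobalDimensionLT.of_adjunction e.symm.toAdjunction,
    GlobalDimensionLT.of_adjunction e.toAdjunction⟩

end GlobalDimension

/-! ### Diagrams in one variable and the constant diagrams -/

/-- Diagrams `M_0 ⟶ ⋯ ⟶ M_m` with a morphism `F M_m ⟶ M_0` such that, for all `k`, the composite
`F M_k ⟶ F M_m ⟶ M_0 ⟶ M_k` is `η M_k`. -/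
structure RootDiagram {C : Type u} [Category.{v} C] {F : C ⥤ C} (η : F ⟶ 𝟭 C) (m : ℕ) where
  obj : Fin (m + 1) → C
  map : ∀ {i j : Fin (m + 1)}, i ≤ j → (obj i ⟶ obj j)
  map_self : ∀ {i : Fin (m + 1)} (h : i ≤ i), map h = 𝟙 (obj i)
  map_map : ∀ {i j k : Fin (m + 1)} (h : i ≤ j) (h' : j ≤ k), map h ≫ map h' = map (h.trans h')
  wrap : F.obj (obj (Fin.last m)) ⟶ obj 0
  cycle : ∀ k, F.map (map (Fin.le_last k)) ≫ wrap ≫ map (Fin.zero_le k) = η.app (obj k)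

namespace RootDiagram

section Basic

variable {C : Type u} [Category.{v} C] {F : C ⥤ C} {η : F ⟶ 𝟭 C} {m : ℕ}

/-- Morphisms of diagrams. -/
@[ext]
structure Hom (X Y : RootDiagram η m) where
  app : ∀ k, X.obj k ⟶ Y.obj k
  naturality : ∀ {i j : Fin (m + 1)} (h : i ≤ j), X.map h ≫ app j = app i ≫ Y.map h
  wrap : X.wrap ≫ app 0 = F.map (app (Fin.last m)) ≫ Y.wrap

attribute [simp] map_self

instance : Category (RootDiagram η m) where
  Hom := Hom
  id X := { app _ := 𝟙 _, naturality := by simp, wrap := by simp }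
  comp f g :=
    { app k := f.app k ≫ g.app k
      naturality := fun h => by rw [reassoc_of% f.naturality, g.naturality, Category.assoc]
      wrap := by rw [reassoc_of% f.wrap, g.wrap, F.map_comp, Category.assoc] }

@[simp] lemma id_app (X : RootDiagram η m) (k) : Hom.app (𝟙 X) k = 𝟙 _ := rfl

@[simp] lemma comp_app {X Y Z : RootDiagram η m} (f : X ⟶ Y) (g : Y ⟶ Z) (k) :
    (f ≫ g).app k = f.app k ≫ g.app k := rfl

@[ext]
lemma hom_ext {X Y : RootDiagram η m} {f g : X ⟶ Y} (h : ∀ k, f.app k = g.app k) : f = g :=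
  Hom.ext (funext h)

/-- The evaluation `M ↦ M_k`. -/
@[reducible]
def ev (η : F ⟶ 𝟭 C) (m : ℕ) (k : Fin (m + 1)) : RootDiagram η m ⥤ C where
  obj X := X.obj k
  map f := f.app k

/-- The constant diagram `X = ⋯ = X`, with `F X ⟶ X` given by `η X`. -/
@[reducible]
def const (η : F ⟶ 𝟭 C) (m : ℕ) : C ⥤ RootDiagram η m where
  obj X :=
    { obj _ := X
      map _ := 𝟙 X
      map_self _ := rfl
      map_map _ _ := Category.comp_id _
      wrap := η.app X
      cycle := by simp }
  map f := { app _ := f, naturality _ := by simp, wrap := by simp }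

lemma cycle_zero (X : RootDiagram η m) :
    F.map (X.map (Fin.le_last 0)) ≫ X.wrap = η.app (X.obj 0) := by
  rw [← X.cycle 0, map_self, Category.comp_id]

lemma cycle_last (X : RootDiagram η m) :
    X.wrap ≫ X.map (Fin.zero_le (Fin.last m)) = η.app (X.obj (Fin.last m)) := by
  rw [← X.cycle (Fin.last m), map_self, F.map_id, Category.id_comp]

/-- The constant diagram functor is left adjoint to the evaluation at `0`. -/
def constAdjEvZero (η : F ⟶ 𝟭 C) (m : ℕ) : const η m ⊣ ev η m 0 :=
  Adjunction.mkOfHomEquiv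
    { homEquiv X M :=
        { toFun f := f.app 0
          invFun g :=
            { app j := g ≫ M.map (Fin.zero_le j)
              naturality h := by rw [Category.id_comp, Category.assoc, map_map]
              wrap := by
                rw [map_self, Category.comp_id, F.map_comp, Category.assoc, cycle_zero]
                exact (η.naturality g).symm }
          left_inv f := by
            ext j
            exact (Hom.naturality f (Fin.zero_le j)).symm.trans (Category.id_comp _)
          right_inv g := by simp } }

/-- The constant diagram functor is right adjoint to the evaluation at the last index. -/
def evLastAdjConst (η : F ⟶ 𝟭 C) (m : ℕ) : ev η m (Fin.last m) ⊣ const η m :=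
  Adjunction.mkOfHomEquiv
    { homEquiv M X :=
        { toFun g :=
            { app j := M.map (Fin.le_last j) ≫ g
              naturality h := by rw [Category.comp_id, reassoc_of% M.map_map]
              wrap := by
                rw [map_self, Category.id_comp, reassoc_of% M.cycle_last]
                exact (η.naturality g).symm }
          invFun f := f.app (Fin.last m)
          left_inv g := by simp
          right_inv f := by
            ext j
            exact (Hom.naturality f (Fin.le_last j)).trans (Category.comp_id _) }
      homEquiv_naturality_left_symm := fun _ _ => rfl
      homEquiv_naturality_right := fun _ _ => by ext; simp }

end Basic

/-! ### Diagrams generated by an object in one degree -/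

section Extend

variable {C : Type u} [Category.{v} C] {F : C ⥤ C} {η : F ⟶ 𝟭 C} {m : ℕ}

open Classical in
/-- The diagram `F X = ⋯ = F X ⟶ X = ⋯ = X`, with `X` in the degrees `≥ k`. -/
noncomputable def free (η : F ⟶ 𝟭 C) (k : Fin (m + 1)) (X : C)
    (hX : F.map (η.app X) = η.app (F.obj X)) : RootDiagram η m where
  obj j := if k ≤ j then X else F.obj X
  map {i j} h := if hi : k ≤ i then eqToHom (by rw [if_pos hi, if_pos (hi.trans h)]) else
    if hj : k ≤ j then eqToHom (if_neg hi) ≫ η.app X ≫ eqToHom (if_pos hj).symm else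
    eqToHom (by rw [if_neg hi, if_neg hj])
  map_self {i} h := by split_ifs <;> rfl
  map_map {i j l} h h' := by
    by_cases hi : k ≤ i
    · simp [hi, hi.trans h, hi.trans (h.trans h')]
    · by_cases hj : k ≤ j
      · simp [hi, hj, hj.trans h']
      · by_cases hl : k ≤ l <;> simp [hi, hj, hl]
  wrap := F.map (eqToHom (if_pos (Fin.le_last k))) ≫
    if hk : k ≤ 0 then η.app X ≫ eqToHom (if_pos hk).symm else eqToHom (if_neg hk).symm
  cycle j := by
    have key : ∀ (Y : C) (e : Y = X), η.app Y = F.map (eqToHom e) ≫ η.app X ≫ eqToHom e.symm := by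
      rintro Y rfl; simp
    -- In degrees below `k` the object is `F X` and going once around gives `F (η X)`. The diagram
    -- law asks for `η (F X)` instead, which is why `hX` is needed.
    have key' : ∀ (Y : C) (e : Y = F.obj X),
        η.app Y = F.map (eqToHom e) ≫ F.map (η.app X) ≫ eqToHom e.symm := by
      rintro Y rfl; simp [hX]
    by_cases hj : k ≤ j
    · by_cases hk : k ≤ 0 
      · rw [key _ (if_pos hj)]
        simp [hj, hk, eqToHom_map]
      · rw [key _ (if_pos hj)]
        simp [hj, hk, eqToHom_map]
    · have hk : ¬ k ≤ 0 := fun hk => hj (hk.trans (Fin.zero_le j))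
      rw [key' _ (if_neg hj)]
      simp [hj, hk, Fin.le_last, eqToHom_map]

/-- The morphism from `free η k X` given by a morphism in degree `k`. -/
lemma exists_free_hom (k : Fin (m + 1)) {X : C} (hX : F.map (η.app X) = η.app (F.obj X))
    (M : RootDiagram η m) (g : X ⟶ M.obj k) :
    ∃ (f : free η k X hX ⟶ M) (e : X ⟶ (free η k X hX).obj k), e ≫ f.app k = g := by
  -- Below degree `k` the morphism is forced to go once around: `F X ⟶ F M_k ⟶ F M_m ⟶ M_0 ⟶ M_j`.
  refine ⟨{ app j := if hj : k ≤ j then eqToHom (if_pos hj) ≫ g ≫ M.map hj else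
              eqToHom (if_neg hj) ≫ F.map (g ≫ M.map (Fin.le_last k)) ≫ M.wrap ≫
                M.map (Fin.zero_le j), naturality := ?_, wrap := ?_ },
    eqToHom (if_pos le_rfl).symm, by simp [free]⟩
  · intro i j h
    by_cases hi : k ≤ i
    · simp [free, hi, hi.trans h, map_map]
    · by_cases hj : k ≤ j
      · have h1 := (reassoc_of% (M.cycle k)) (M.map hj)
        rw [map_map] at h1
        simp [free, hi, hj, map_map, h1]
      · simp [free, hi, hj, map_map]
  · by_cases hk : k ≤ 0
    · obtain rfl : k = 0 := le_antisymm hk (Fin.zero_le k)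
      simp [free, cycle_zero]
    · simp [free, hk, Fin.le_last]

end Extend

/-! ### The zero locus, skyscrapers and cokernels -/

/-- The objects `X` with `η X = 0`. -/
def zeroLocus {C : Type u} [Category.{v} C] [HasZeroMorphisms C] {F : C ⥤ C} (η : F ⟶ 𝟭 C) :
    ObjectProperty C := fun X => η.app X = 0

section ZeroLocus

variable {C : Type u} [Category.{v} C] [Abelian C] {F : C ⥤ C} {η : F ⟶ 𝟭 C}

instance : (zeroLocus η).ContainsZero where
  exists_zero := ⟨0, isZero_zero C, (isZero_zero C).eq_of_tgt _ _⟩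

instance : (zeroLocus η).IsClosedUnderSubobjects where
  prop_of_mono {X Y} f _ hY := by
    have h := η.naturality f
    rw [show η.app Y = 0 from hY, comp_zero] at h
    exact (cancel_mono f).1 (by rw [zero_comp]; exact h.symm)

instance [F.PreservesEpimorphisms] : (zeroLocus η).IsClosedUnderQuotients where
  prop_of_epi {X Y} f _ hX := by
    have h := η.naturality f
    rw [show η.app X = 0 from hX, zero_comp] at h
    exact (cancel_epi (F.map f)).1 (by rw [comp_zero]; exact h)

instance : (zeroLocus η).IsClosedUnderFiniteProducts where
  isClosedUnderLimitsOfShape J _ :=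
    { limitsOfShape_le := by
        rintro X ⟨h⟩
        refine h.isLimit.hom_ext fun j => ?_
        have h1 := η.naturality (h.π.app j)
        rw [show η.app _ = 0 from h.prop_diag_obj j, comp_zero] at h1
        rw [zero_comp]
        exact h1.symm }

end ZeroLocus

section Sky

variable {C : Type u} [Category.{v} C] [Abelian C] {F : C ⥤ C} (η : F ⟶ 𝟭 C) {m : ℕ}

lemma app_eq_zero_of_isZero {X : C} (hX : IsZero X) : η.app X = 0 := hX.eq_of_tgt _ _

open Classical in
/-- The diagram which is `X` in degree `k + 1` and zero in all other degrees. -/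
noncomputable def skyObj (k : Fin m) (X : C) (hX : zeroLocus η X) : RootDiagram η m where
  obj j := if j = k.succ then X else 0
  map {i j} h := if h' : i = k.succ ∧ j = k.succ then
    eqToHom (by rw [if_pos h'.1, if_pos h'.2]) else 0
  map_self {i} h := by
    by_cases hi : i = k.succ
    · simp [hi]
    · exact IsZero.eq_of_src (by rw [if_neg hi]; exact isZero_zero C) _ _
  map_map {i j l} h h' := by
    by_cases hi : i = k.succ
    · by_cases hl : l = k.succ
      · obtain rfl : j = k.succ := le_antisymm (hl ▸ h') (hi ▸ h)
        simp [hi, hl]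
      · simp [hl]
    · simp [hi]
  wrap := 0
  cycle j := by
    rw [zero_comp, comp_zero]
    by_cases hj : j = k.succ
    · rw [if_pos hj]
      exact hX.symm
    · rw [if_neg hj]
      exact (app_eq_zero_of_isZero η (isZero_zero C)).symm

variable {η}

lemma isZero_skyObj (k : Fin m) {X : C} (hX : zeroLocus η X) (j : Fin (m + 1)) (hj : j ≠ k.succ) :
    IsZero ((skyObj η k X hX).obj j) := by
  dsimp only [skyObj]
  rw [if_neg hj]
  exact isZero_zero C

/-- The component of `skyObj η k X` in degree `k + 1`. -/
noncomputable def skyIso (k : Fin m) {X : C} (hX : zeroLocus η X) :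
    (skyObj η k X hX).obj k.succ ≅ X := eqToIso (if_pos rfl)

open Classical in
/-- The morphism to `skyObj η k X` given by a morphism in degree `k + 1` which vanishes on the
preceding object. -/
noncomputable def toSky (k : Fin m) {X : C} (hX : zeroLocus η X) (M : RootDiagram η m)
    (g : M.obj k.succ ⟶ X) (hg : M.map k.castSucc_le_succ ≫ g = 0) : M ⟶ skyObj η k X hX where
  app j := if h : j = k.succ then M.map h.le ≫ g ≫ (skyIso k hX).inv ≫
    (skyObj η k X hX).map h.ge else 0
  naturality {i j} h := by
    by_cases hj : j = k.succ
    · by_cases hi : i = k.succ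
      · subst hi hj
        simp
      -- A transition into degree `k + 1` from a lower degree factors through degree `k`, on which
      -- `g` vanishes by `hg`.
      · have h' : i ≤ k.castSucc := by
          rw [Fin.le_castSucc_iff]
          exact lt_of_le_of_ne (hj ▸ h) hi
        rw [dif_pos hj, dif_neg hi, zero_comp, ← Category.assoc, map_map,
          ← M.map_map h' k.castSucc_le_succ, Category.assoc, reassoc_of% hg, zero_comp, comp_zero]
    · exact (isZero_skyObj k hX j hj).eq_of_tgt _ _
  wrap := (isZero_skyObj k hX 0 (Fin.succ_ne_zero k).symm).eq_of_tgt _ _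

@[simp]
lemma toSky_app (k : Fin m) {X : C} (hX : zeroLocus η X) (M : RootDiagram η m)
    (g : M.obj k.succ ⟶ X) (hg : M.map k.castSucc_le_succ ≫ g = 0) :
    (toSky k hX M g hg).app k.succ = g ≫ (skyIso k hX).inv := by
  simp [toSky]

lemma hom_sky_ext {k : Fin m} {X : C} {hX : zeroLocus η X} {M : RootDiagram η m}
    {f g : M ⟶ skyObj η k X hX} (h : f.app k.succ = g.app k.succ) : f = g := by
  ext j
  by_cases hj : j = k.succ
  · subst hj; exact h
  · exact (isZero_skyObj k hX j hj).eq_of_tgt _ _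

lemma map_comp_sky {k : Fin m} {X : C} {hX : zeroLocus η X} {M : RootDiagram η m}
    (f : M ⟶ skyObj η k X hX) : M.map k.castSucc_le_succ ≫ f.app k.succ = 0 := by
  rw [f.naturality, (isZero_skyObj k hX _ Fin.castSucc_lt_succ.ne).eq_of_tgt (f.app k.castSucc) 0,
    zero_comp]

variable (η) in
/-- The functor which places an object `X` with `η X = 0` in degree `k + 1`. -/
@[reducible]
noncomputable def sky (k : Fin m) : (zeroLocus η).FullSubcategory ⥤ RootDiagram η m where
  obj X := skyObj η k X.obj X.property
  map {X Y} f := toSky k Y.property _ ((skyIso k X.property).hom ≫ f.hom) (by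
    rw [(isZero_skyObj k X.property _ Fin.castSucc_lt_succ.ne).eq_of_src (map _ _) 0, zero_comp])
  map_id X := hom_sky_ext (by simp)
  map_comp f g := hom_sky_ext (by simp)

/-- The cycle at `k + 1` comes back through `M_0`, so `η M_{k+1}` factors through `M_k ⟶ M_{k+1}`
and dies in the cokernel. This works because degree `0` is excluded: all skyscrapers sit in degrees
`k + 1`. -/
lemma zeroLocus_cokernel_map [F.PreservesEpimorphisms] (M : RootDiagram η m) (k : Fin m) :
    zeroLocus η (cokernel (M.map k.castSucc_le_succ)) := by
  change η.app _ = 0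
  rw [← cancel_epi (F.map (cokernel.π (M.map k.castSucc_le_succ))), comp_zero]
  have h := η.naturality (cokernel.π (M.map k.castSucc_le_succ))
  dsimp at h
  rw [h, ← M.cycle, ← M.map_map (Fin.zero_le _) k.castSucc_le_succ]
  simp

variable (η) in
/-- The cokernel of `M_k ⟶ M_{k+1}`. -/
@[reducible]
noncomputable def coker [F.PreservesEpimorphisms] (k : Fin m) :
    RootDiagram η m ⥤ (zeroLocus η).FullSubcategory where
  obj M := ⟨cokernel (M.map k.castSucc_le_succ), zeroLocus_cokernel_map M k⟩
  map {M N} f := ObjectProperty.homMk (cokernel.map _ _ (f.app k.castSucc) (f.app k.succ)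
    (f.naturality _))

variable (η) in
/-- The cokernel functor is left adjoint to the functor `sky`. -/
noncomputable def cokerAdjSky [F.PreservesEpimorphisms] (k : Fin m) : coker η k ⊣ sky η k :=
  Adjunction.mkOfHomEquiv
    { homEquiv M X :=
        { toFun g := toSky k X.property M (cokernel.π _ ≫ g.hom) (by simp)
          invFun f := ObjectProperty.homMk (cokernel.desc _ (f.app k.succ ≫ (skyIso k X.property).hom)
            (by rw [← Category.assoc, map_comp_sky, zero_comp]))
          left_inv g := by
            ext
            simp
          right_inv f := hom_sky_ext (by simp) }
      homEquiv_naturality_left_symm f g := by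
        ext
        simp
      homEquiv_naturality_right {_ _ Z} f g := hom_sky_ext (hX := Z.property) (by simp) }

end Sky

end RootDiagram

/-! ### Exactness for diagrams, given an abelian structure with exact evaluations -/

namespace RootDiagram

universe w₁ w₂ w₃

open Abelian

variable {C : Type u} [Category.{v} C] [Abelian C] {F : C ⥤ C} {η : F ⟶ 𝟭 C} {m : ℕ}
  [Abelian (RootDiagram η m)] [∀ k, PreservesFiniteLimits (ev η m k)]
  [∀ k, PreservesFiniteColimits (ev η m k)]

instance (k : Fin (m + 1)) : (ev η m k).Additive := Functor.additive_of_preserves_binary_products _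

@[simp]
lemma zero_app (X Y : RootDiagram η m) (k : Fin (m + 1)) : Hom.app (0 : X ⟶ Y) k = 0 :=
  (ev η m k).map_zero X Y

lemma isZero_of_obj {X : RootDiagram η m} (h : ∀ k, IsZero (X.obj k)) : IsZero X := by
  rw [IsZero.iff_id_eq_zero]
  ext k
  exact (h k).eq_of_src _ _

lemma isZero_obj {X : RootDiagram η m} (h : IsZero X) (k : Fin (m + 1)) : IsZero (X.obj k) :=
  (ev η m k).map_isZero h

lemma mono_of_app {X Y : RootDiagram η m} (f : X ⟶ Y) (h : ∀ k, Mono (f.app k)) : Mono f :=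
  ⟨fun g g' hg => by
    ext k
    have := h k
    rw [← cancel_mono (f.app k), ← comp_app, hg, comp_app]⟩

lemma epi_of_app {X Y : RootDiagram η m} (f : X ⟶ Y) (h : ∀ k, Epi (f.app k)) : Epi f :=
  ⟨fun g g' hg => by
    ext k
    have := h k
    rw [← cancel_epi (f.app k), ← comp_app, hg, comp_app]⟩

instance mono_app {X Y : RootDiagram η m} (f : X ⟶ Y) [Mono f] (k : Fin (m + 1)) :
    Mono (f.app k) :=
  (ev η m k).map_mono f

instance epi_app {X Y : RootDiagram η m} (f : X ⟶ Y) [Epi f] (k : Fin (m + 1)) :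
    Epi (f.app k) :=
  (ev η m k).map_epi f

/-- Being right adjoint to the last evaluation and left adjoint to the evaluation at `0`, the
constant functor is exact on both sides. -/
instance : PreservesFiniteLimits (const η m) :=
  have := (evLastAdjConst η m).rightAdjoint_preservesLimits
  inferInstance

instance : PreservesFiniteColimits (const η m) :=
  have := (constAdjEvZero η m).leftAdjoint_preservesColimits
  inferInstance

instance : (const η m).Full where
  map_surjective {X Y} f := ⟨f.app 0, by
    ext j
    exact ((Category.id_comp _).symm.trans (Hom.naturality f (Fin.zero_le j))).trans
      (Category.comp_id _) |>.symm⟩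

instance : (const η m).Faithful where
  map_injective h := congrArg (fun f => Hom.app f 0) h

section Cover

/-- Sums of the diagrams `free η l Q`, one for each degree `l`, cover `M`: the one for `l` is epi
onto `M_l` when `Q ⟶ M_l` is. Their components are sums of objects `Q` and `F Q`, so they stay in
`W`. -/
lemma exists_cover (W : ObjectProperty C) [W.IsClosedUnderIsomorphisms] (hW0 : W 0)
    (hW : ∀ X Y, W X → W Y → W (X ⊞ Y)) (hF : ∀ X, W X → W (F.obj X))
    (hη : ∀ X, F.map (η.app X) = η.app (F.obj X))
    (hC : ∀ X : C, ∃ (Q : C) (q : Q ⟶ X), W Q ∧ Epi q) (M : RootDiagram η m) :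
    ∃ (M' : RootDiagram η m) (q : M' ⟶ M), (∀ k, W (M'.obj k)) ∧ Epi q := by
  have key (l : ℕ) : ∃ (M' : RootDiagram η m) (q : M' ⟶ M), (∀ k, W (M'.obj k)) ∧
      ∀ j : Fin (m + 1), j.val < l → Epi (q.app j) := by
    induction l with
    | zero =>
      exact ⟨0, 0, fun k => W.prop_of_iso ((isZero_obj (isZero_zero _) k).isoZero).symm hW0,
        fun j hj => absurd hj (Nat.not_lt_zero _)⟩
    | succ l ih =>
      obtain ⟨M', q, h1, h2⟩ := ih
      by_cases hl : l < m + 1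
      · obtain ⟨Q, r, hQ, hr⟩ := hC (M.obj ⟨l, hl⟩)
        obtain ⟨f, e, hf⟩ := exists_free_hom ⟨l, hl⟩ (hη Q) M r
        refine ⟨M' ⊞ free η ⟨l, hl⟩ Q (hη Q), biprod.desc q f, fun k => ?_, fun j hj => ?_⟩
        · have : PreservesBinaryBiproducts (ev η m k) :=
            preservesBinaryBiproducts_of_preservesBinaryProducts _
          refine W.prop_of_iso ((ev η m k).mapBiprod M' (free η ⟨l, hl⟩ Q (hη Q))).symm
            (hW _ _ (h1 k) ?_)
          dsimp only [ev, free]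
          split_ifs
          · exact hQ
          · exact hF _ hQ
        · by_cases hj' : j.val = l
          · obtain rfl : j = ⟨l, hl⟩ := Fin.ext hj'
            have h3 : e ≫ (biprod.inr : _ ⟶ M' ⊞ free η ⟨l, hl⟩ Q (hη Q)).app ⟨l, hl⟩ ≫
                (biprod.desc q f).app ⟨l, hl⟩ = r := by
              rw [← comp_app, biprod.inr_desc, hf]
            rw [← Category.assoc] at h3
            exact epi_of_epi_fac h3
          · have := h2 j (by omega)
            have h3 : (biprod.inl : M' ⟶ M' ⊞ free η ⟨l, hl⟩ Q (hη Q)).app j ≫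
                (biprod.desc q f).app j = q.app j := by
              rw [← comp_app, biprod.inl_desc]
            exact epi_of_epi_fac h3
      · exact ⟨M', q, h1, fun j _ => h2 j (by omega)⟩
  obtain ⟨M', q, h1, h2⟩ := key (m + 1)
  exact ⟨M', q, h1, epi_of_app q fun k => h2 k k.isLt⟩

end Cover

section Sky

lemma sky_map_app {k : Fin m} {X Y : (zeroLocus η).FullSubcategory} (f : X ⟶ Y) :
    ((sky η k).map f).app k.succ =
      (skyIso k X.property).hom ≫ f.hom ≫ (skyIso k Y.property).inv := by
  simp

variable [F.PreservesEpimorphisms]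

instance (k : Fin m) : PreservesFiniteLimits (sky η k) :=
  have := (cokerAdjSky η k).rightAdjoint_preservesLimits
  inferInstance

instance (k : Fin m) : (sky η k).Additive := Functor.additive_of_preserves_binary_products _

instance (k : Fin m) : PreservesFiniteColimits (coker η (m := m) k) :=
  have := (cokerAdjSky η k).leftAdjoint_preservesColimits
  inferInstance

instance (k : Fin m) : (coker η (m := m) k).Additive :=
  (cokerAdjSky η k).left_adjoint_additive

instance (k : Fin m) : (sky η k).PreservesEpimorphisms where
  preserves {X Y} f _ := epi_of_app _ fun j => by
    by_cases hj : j = k.succ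
    · subst hj
      rw [sky_map_app]
      have := (zeroLocus η).preservesEpimorphisms_ι_of_isNormalMonoCategory
      have : Epi f.hom := inferInstanceAs (Epi ((zeroLocus η).ι.map f))
      infer_instance
    · exact ⟨fun _ _ _ => (isZero_skyObj k Y.property j hj).eq_of_src _ _⟩

instance (k : Fin m) : PreservesFiniteColimits (sky η k) := by
  have key : (∀ S : ShortComplex _, S.ShortExact → (S.map (sky η k)).ShortExact) ↔
      PreservesFiniteLimits (sky η k) ∧ PreservesFiniteColimits (sky η k) :=
    (Functor.exact_tfae (sky η k)).out 0 3
  refine (key.1 fun S hS => ?_).2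
  have key' : PreservesFiniteLimits (sky η k) ↔ ∀ S : ShortComplex _, S.ShortExact →
      (S.map (sky η k)).Exact ∧ Mono ((sky η k).map S.f) :=
    (Functor.preservesFiniteLimits_tfae (sky η k)).out 3 0
  have h := key'.1 inferInstance S hS
  have := hS.epi_g
  exact { exact := h.1, mono_f := h.2, epi_g := (sky η k).map_epi S.g }

instance (k : Fin m) : (sky η k).Full where
  map_surjective {X Y} f :=
    ⟨ObjectProperty.homMk ((skyIso k X.property).inv ≫ f.app k.succ ≫ (skyIso k Y.property).hom),
      hom_sky_ext (hX := Y.property) (by simp)⟩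

instance (k : Fin m) : (sky η k).Faithful where
  map_injective {X Y f g} h := by
    have := congrArg (fun f => Hom.app f k.succ) h
    dsimp only at this
    rw [sky_map_app, sky_map_app] at this
    ext
    simpa using this

/-- The diagrams such that `M_k ⟶ M_{k+1}` is a monomorphism. -/
def monoAt (η : F ⟶ 𝟭 C) (k : Fin m) : ObjectProperty (RootDiagram η m) :=
  fun M => Mono (M.map k.castSucc_le_succ)

instance (k : Fin m) : (monoAt η k).IsClosedUnderSubobjects where
  prop_of_mono {X Y} f _ hY := by
    have : Mono (Y.map k.castSucc_le_succ) := hY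
    have h : X.map k.castSucc_le_succ ≫ f.app k.succ = _ := f.naturality k.castSucc_le_succ
    exact mono_of_mono_fac h

/-- An element of `X₂` in degree `k` that lands in `X₁` in degree `k + 1` maps to the kernel of the
transition of `X₃`, which is zero; so it already comes from `X₁`. -/
lemma isPullback_of_shortExact (k : Fin m) {S : ShortComplex (RootDiagram η m)}
    (hS : S.ShortExact) (h₃ : monoAt η k S.X₃) :
    IsPullback (S.X₁.map k.castSucc_le_succ) (S.f.app k.castSucc) (S.f.app k.succ)
      (S.X₂.map k.castSucc_le_succ) := by
  have : Mono (S.X₃.map k.castSucc_le_succ) := h₃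
  have := hS.mono_f
  have hk : (ShortComplex.mk (S.f.app k.castSucc) (S.g.app k.castSucc)
    (by rw [← comp_app, S.zero, zero_app])).ShortExact := hS.map_of_exact (ev η m k.castSucc)
  have h0 : S.f.app k.succ ≫ S.g.app k.succ = 0 := by rw [← comp_app, S.zero, zero_app]
  have key {W : C} (s : W ⟶ S.X₁.obj k.succ) (t : W ⟶ S.X₂.obj k.castSucc)
      (h : s ≫ S.f.app k.succ = t ≫ S.X₂.map k.castSucc_le_succ) :
      t ≫ S.g.app k.castSucc = 0 := by
    rw [← cancel_mono (S.X₃.map k.castSucc_le_succ), zero_comp, Category.assoc,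
      ← S.g.naturality, ← reassoc_of% h, h0, comp_zero]
  have key' {W : C} (s : W ⟶ S.X₁.obj k.succ) (t : W ⟶ S.X₂.obj k.castSucc)
      (h : s ≫ S.f.app k.succ = t ≫ S.X₂.map k.castSucc_le_succ) :
      ∃ l : W ⟶ S.X₁.obj k.castSucc, l ≫ S.f.app k.castSucc = t :=
    ⟨hk.exact.lift t (key s t h), hk.exact.lift_f _ _⟩
  choose l hl using @key'
  refine ⟨⟨S.f.naturality _⟩, ⟨PullbackCone.IsLimit.mk _ (fun c => l c.fst c.snd c.condition)
    (fun c => ?_) (fun c => hl _ _ _) (fun c n _ h2 => ?_)⟩⟩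
  · rw [← cancel_mono (S.f.app k.succ), Category.assoc, S.f.naturality, reassoc_of% hl, c.condition]
  · rw [← cancel_mono (S.f.app k.castSucc), hl, h2]

/-- `coker` is right exact as a left adjoint. Injectivity on the left holds because a pullback
square induces a monomorphism between the cokernels. -/
lemma shortExact_map_coker (k : Fin m) {S : ShortComplex (RootDiagram η m)}
    (hS : S.ShortExact) (h₃ : monoAt η k S.X₃) : (S.map (coker η k)).ShortExact := by
  have h := (Functor.preservesFiniteColimits_iff_forall_exact_map_and_epi (coker η k)).1
    inferInstance S hS
  refine { exact := h.1, epi_g := h.2, mono_f := ?_ }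
  have := Abelian.mono_cokernel_map_of_isPullback (isPullback_of_shortExact k hS h₃)
  exact (zeroLocus η).ι.mono_of_mono_map this

end Sky

end RootDiagram

/-! ### Vanishing of `Ext` into constant diagrams, skyscrapers and general diagrams -/

namespace RootDiagram

universe w₁ w₂ w₃

open Abelian

variable {C : Type u} [Category.{v} C] [Abelian C] {F : C ⥤ C} {η : F ⟶ 𝟭 C} {m : ℕ}
  [Abelian (RootDiagram η m)] [∀ k, PreservesFiniteLimits (ev η m k)]
  [∀ k, PreservesFiniteColimits (ev η m k)] [F.PreservesEpimorphisms]
  [HasExt.{w₁} (RootDiagram η m)] [HasExt.{w₂} (zeroLocus η).FullSubcategory] [HasExt.{w₃} C]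

lemma ext_sky_eq_zero_of_monoAt {k : Fin m}
    (hk : ∀ X : RootDiagram η m, ∃ (M : RootDiagram η m) (q : M ⟶ X), monoAt η k M ∧ Epi q)
    {N : ℕ} (h : GlobalDimensionLT (zeroLocus η).FullSubcategory N) {M : RootDiagram η m}
    (hM : monoAt η k M) (Y : (zeroLocus η).FullSubcategory) {i : ℕ} (hi : N ≤ i)
    (e : Ext M ((sky η k).obj Y) i) : e = 0 := by
  rw [globalDimensionLT_iff.{w₂}] at h
  obtain ⟨e', rfl⟩ := ((cokerAdjSky η k).extMap_bijective (monoAt η k) hk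
    (fun S hS _ h₃ => shortExact_map_coker k hS h₃) Y i M hM).2 e
  rw [h _ _ i hi e', Adjunction.extMap_zero]

/-- For general `M` one degree is lost: a cover with mono transition at `k` and its kernel are both
in `monoAt`, and the connecting map shifts the degree by one. -/
lemma ext_sky_eq_zero {k : Fin m}
    (hk : ∀ X : RootDiagram η m, ∃ (M : RootDiagram η m) (q : M ⟶ X), monoAt η k M ∧ Epi q)
    {N : ℕ} (h : GlobalDimensionLT (zeroLocus η).FullSubcategory N) (M : RootDiagram η m)
    (Y : (zeroLocus η).FullSubcategory) {i : ℕ} (hi : N ≤ i)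
    (e : Ext M ((sky η k).obj Y) (i + 1)) : e = 0 := by
  obtain ⟨M', q, hM', hq⟩ := hk M
  have hS : (ShortComplex.mk (kernel.ι q) q (kernel.condition _)).ShortExact :=
    { exact := ShortComplex.exact_kernel _ }
  have h0 : (Ext.mk₀ q).comp e (zero_add _) = 0 :=
    ext_sky_eq_zero_of_monoAt hk h hM' Y (Nat.le_succ_of_le hi) _
  obtain ⟨e', rfl⟩ := Ext.contravariant_sequence_exact₃ hS _ e h0 (add_comm 1 i)
  rw [ext_sky_eq_zero_of_monoAt hk h
    ((monoAt η k).prop_of_mono (kernel.ι q) hM') Y hi e', Ext.comp_zero]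

lemma ext_const_eq_zero {N : ℕ} (h : GlobalDimensionLT C N) (M : RootDiagram η m) (Y : C) {i : ℕ}
    (hi : N ≤ i) (e : Ext M ((const η m).obj Y) i) : e = 0 := by
  rw [globalDimensionLT_iff.{w₃}] at h
  have : (const η m).Additive := Functor.additive_of_preserves_binary_products _
  obtain ⟨e', rfl⟩ := ((evLastAdjConst η m).extMap_bijective_of_exact Y i M).2 e
  rw [h _ _ i hi e', Adjunction.extMap_zero]

lemma isZero_obj_of_mono {X Y : RootDiagram η m} (f : X ⟶ Y) [Mono f] {k : Fin (m + 1)}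
    (h : IsZero (Y.obj k)) : IsZero (X.obj k) :=
  h.of_mono (f.app k)

/-- Dévissage on the number `d` of top degrees in which `X` may be nonzero. As `d ≤ m`, the lowest
of these is positive, and `X` maps onto the skyscraper of its component there, with kernel supported
in fewer degrees. -/
lemma ext_eq_zero_of_sky {M : RootDiagram η m} {i : ℕ}
    (hsky : ∀ (k : Fin m) (Y : (zeroLocus η).FullSubcategory) (e : Ext M ((sky η k).obj Y) i),
      e = 0) (d : ℕ) (hd : d ≤ m) (X : RootDiagram η m)
    (hX : ∀ j : Fin (m + 1), j.val + d < m + 1 → IsZero (X.obj j)) (e : Ext M X i) : e = 0 := by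
  induction d generalizing X with
  | zero =>
    have : IsZero X := isZero_of_obj fun j => hX j j.isLt
    rw [← e.comp_mk₀_id, this.eq_of_src (𝟙 X) 0, Ext.mk₀_zero, Ext.comp_zero]
  | succ d ih =>
    -- The lowest possibly nonzero degree is `m - d = k + 1`. Since `X_k = 0`, the cokernel at `k`
    -- is the whole component `X_{k+1}`.
    let k : Fin m := ⟨m - d - 1, by omega⟩
    let g : X ⟶ (sky η k).obj ⟨_, zeroLocus_cokernel_map X k⟩ :=
      toSky k (zeroLocus_cokernel_map X k) X (cokernel.π _) (cokernel.condition _)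
    have hg : g.app k.succ = cokernel.π _ ≫ (skyIso k (zeroLocus_cokernel_map X k)).inv :=
      toSky_app _ _ _ _ _
    have h0 : IsZero (X.obj k.castSucc) := hX _ (by simp [k]; omega)
    have hg' : Mono (g.app k.succ) := by
      have : Mono (cokernel.π (X.map k.castSucc_le_succ)) := by
        rw [h0.eq_of_src (X.map k.castSucc_le_succ) 0]
        infer_instance
      rw [hg]
      exact mono_comp _ _
    have : Epi g := epi_of_app _ fun j => by
      by_cases hj : j = k.succ
      · subst hj
        rw [hg]
        exact epi_comp _ _
      · exact ⟨fun _ _ _ => (isZero_skyObj k (zeroLocus_cokernel_map X k) j hj).eq_of_src _ _⟩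
    have hS : (ShortComplex.mk (kernel.ι g) g (kernel.condition _)).ShortExact :=
      { exact := ShortComplex.exact_kernel _ }
    obtain ⟨e', rfl⟩ := Ext.covariant_sequence_exact₂ M hS e (hsky k _ _)
    rw [ih (by omega) (kernel g) (fun j hj => ?_) e', Ext.zero_comp]
    by_cases hj' : j = k.succ
    · subst hj'
      rw [IsZero.iff_id_eq_zero, ← cancel_mono ((kernel.ι g).app k.succ),
        ← cancel_mono (g.app k.succ), Category.assoc, ← comp_app, kernel.condition]
      simp
    · refine isZero_obj_of_mono (kernel.ι g) (hX j ?_)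
      have : j.val ≠ m - d - 1 + 1 := fun h => hj' (Fin.ext h)
      omega

/-- Kernel and cokernel of the counit `const X_0 ⟶ X` vanish in degree `0`, so they are built from
skyscrapers. The cokernel is needed in degree `i` and the kernel in degree `i + 1`, whence the
hypothesis for all `j ≥ i`. -/
lemma ext_eq_zero {M : RootDiagram η m} {i : ℕ}
    (hsky : ∀ (k : Fin m) (Y : (zeroLocus η).FullSubcategory) (j : ℕ) (_ : i ≤ j)
      (e : Ext M ((sky η k).obj Y) j), e = 0)
    (hconst : ∀ (Y : C) (e : Ext M ((const η m).obj Y) i), e = 0)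
    (X : RootDiagram η m) (e : Ext M X i) : e = 0 := by
  have key (j : ℕ) (hj : i ≤ j) (Z : RootDiagram η m) (hZ : IsZero (Z.obj 0)) (e : Ext M Z j) :
      e = 0 :=
    ext_eq_zero_of_sky (fun k Y e => hsky k Y j hj e) m le_rfl Z (fun l hl => by
      obtain rfl : l = 0 := Fin.ext (show l.val = 0 by omega)
      exact hZ) e
  let f : (const η m).obj (X.obj 0) ⟶ X := (constAdjEvZero η m).counit.app X
  have hf : f.app 0 = 𝟙 _ := by
    simp [f, constAdjEvZero]
  let f' := Abelian.factorThruCoimage f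
  have hf' : (Abelian.coimage.π f).app 0 ≫ f'.app 0 = 𝟙 _ := by
    rw [← comp_app, Abelian.coimage.fac, hf]
  have hS₁ : (ShortComplex.mk f' (cokernel.π f') (cokernel.condition _)).ShortExact :=
    { exact := ShortComplex.exact_cokernel _ }
  have hS₂ : (ShortComplex.mk (kernel.ι f) (Abelian.coimage.π f)
      (Abelian.comp_coimage_π_eq_zero (kernel.condition f))).ShortExact :=
    { exact := ShortComplex.exact_cokernel _ }
  have h1 : IsZero ((cokernel f').obj 0) := by
    have : Epi (f'.app 0) := epi_of_epi_fac hf'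
    rw [IsZero.iff_id_eq_zero, ← cancel_epi ((cokernel.π f').app 0), ← cancel_epi (f'.app 0),
      ← Category.assoc, ← comp_app, cokernel.condition]
    simp
  have h2 : IsZero ((kernel f).obj 0) := by
    have : Mono (f.app 0) := by rw [hf]; infer_instance
    rw [IsZero.iff_id_eq_zero, ← cancel_mono ((kernel.ι f).app 0), ← cancel_mono (f.app 0),
      Category.assoc, ← comp_app, kernel.condition]
    simp
  obtain ⟨e', rfl⟩ := Ext.covariant_sequence_exact₂ M hS₁ e (key i le_rfl _ h1 _)
  obtain ⟨e'', rfl⟩ := Ext.covariant_sequence_exact₃ M hS₂ e' rfl (key (i + 1) (by omega) _ h2 _)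
  rw [hconst _ e'', Ext.zero_comp, Ext.zero_comp]

/-- The top skyscraper of `X` embeds in `const X`, since nothing follows the last degree. `Ext^i
(const X) (sky Y)` is `Ext^i` from `X` into the degree `0` part of `sky Y`, which is zero. Hence
`Ext^i (sky X) (sky Y)` embeds in `Ext^{i+1}` from the quotient of `const X` by `sky X`, which
vanishes for `N ≤ i + 1`. -/
lemma skyLast_ext_eq_zero {N : ℕ} {m : ℕ} [Abelian (RootDiagram η (m + 1))]
    [∀ k, PreservesFiniteLimits (ev η (m + 1) k)] [∀ k, PreservesFiniteColimits (ev η (m + 1) k)]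
    [HasExt.{w₁} (RootDiagram η (m + 1))] (h : GlobalDimensionLT (RootDiagram η (m + 1)) N)
    (X Y : (zeroLocus η).FullSubcategory) {i : ℕ} (hi : N ≤ i + 1)
    (e : Ext ((sky η (Fin.last m)).obj X) ((sky η (Fin.last m)).obj Y) i) : e = 0 := by
  rw [globalDimensionLT_iff.{w₁}] at h
  let f : (sky η (Fin.last m)).obj X ⟶ (const η (m + 1)).obj X.obj :=
    (evLastAdjConst η (m + 1)).homEquiv _ _ (skyIso (Fin.last m) X.property).hom
  have : Mono f := mono_of_app _ fun j => by
    by_cases hj : j = (Fin.last m).succ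
    · subst hj
      have : f.app (Fin.last m).succ = (skyIso (Fin.last m) X.property).hom := by
        simp only [f, evLastAdjConst, Adjunction.mkOfHomEquiv_homEquiv]
        exact (congrArg (· ≫ (skyIso (Fin.last m) X.property).hom)
          (((sky η (Fin.last m)).obj X).map_self le_rfl)).trans (Category.id_comp _)
      rw [this]
      infer_instance
    · exact ⟨fun _ _ _ => (isZero_skyObj _ X.property j hj).eq_of_tgt _ _⟩
  have hS : (ShortComplex.mk f (cokernel.π f) (cokernel.condition _)).ShortExact :=
    { exact := ShortComplex.exact_cokernel _ }
  obtain ⟨e', rfl⟩ := Ext.contravariant_sequence_exact₁ hS _ e (add_comm 1 i)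
    (h _ _ (i + 1) hi _)
  have he' : e' = 0 := by
    have : (const η (m + 1)).Additive := Functor.additive_of_preserves_binary_products _
    apply ((constAdjEvZero η (m + 1)).extMap_bijective_of_exact _ i X.obj).1
    have hz : IsZero ((ev η (m + 1) 0).obj ((sky η (Fin.last m)).obj Y)) :=
      isZero_skyObj (Fin.last m) Y.property 0 (Fin.succ_ne_zero _).symm
    have (x : Ext X.obj ((ev η (m + 1) 0).obj ((sky η (Fin.last m)).obj Y)) i) : x = 0 := by
      rw [← x.comp_mk₀_id, hz.eq_of_src (𝟙 _) 0, Ext.mk₀_zero, Ext.comp_zero]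
    rw [this (Adjunction.extMap _ _ _ _ _), this (Adjunction.extMap _ _ _ _ _)]
  rw [he', Ext.comp_zero]

end RootDiagram

/-! ### Objects with mono `η`, and the theorem in one variable -/

/-- The objects `X` such that `η X` is a monomorphism. -/
def monoLocus {C : Type u} [Category.{v} C] {F : C ⥤ C} (η : F ⟶ 𝟭 C) : ObjectProperty C :=
  fun X => Mono (η.app X)

section MonoLocus

variable {C : Type u} [Category.{v} C] [Abelian C] {F : C ⥤ C} (η : F ⟶ 𝟭 C)

instance : (monoLocus η).IsClosedUnderIsomorphisms where
  of_iso {X Y} e hX := by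
    have : Mono (η.app X) := hX
    have h : F.map e.inv ≫ η.app X ≫ e.hom = η.app Y := by
      rw [← Category.assoc, η.naturality]
      simp
    change Mono (η.app Y)
    rw [← h]
    infer_instance

lemma monoLocus_biprod [F.Additive] {X Y : C} (hX : monoLocus η X) (hY : monoLocus η Y) :
    monoLocus η (X ⊞ Y) := by
  have : Mono (η.app X) := hX
  have : Mono (η.app Y) := hY
  refine Preadditive.mono_of_cancel_zero _ fun g hg => ?_
  have h1 : g ≫ F.map biprod.fst = 0 := by
    rw [← cancel_mono (η.app X), zero_comp, Category.assoc, η.naturality, reassoc_of% hg, zero_comp]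
  have h2 : g ≫ F.map biprod.snd = 0 := by
    rw [← cancel_mono (η.app Y), zero_comp, Category.assoc, η.naturality, reassoc_of% hg, zero_comp]
  have h3 : (𝟙 (F.obj (X ⊞ Y))) = F.map biprod.fst ≫ F.map biprod.inl +
      F.map biprod.snd ≫ F.map biprod.inr := by
    rw [← F.map_comp, ← F.map_comp, ← F.map_add, biprod.total, F.map_id]
  rw [← Category.comp_id g, h3, Preadditive.comp_add, reassoc_of% h1, reassoc_of% h2, zero_comp,
    zero_comp, add_zero]

lemma map_app_eq_of_monoLocus {X : C} (hX : monoLocus η X) :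
    F.map (η.app X) = η.app (F.obj X) := by
  have : Mono (η.app X) := hX
  rw [← cancel_mono (η.app X)]
  exact η.naturality (η.app X)

/-- Naturality of `η` at `η X` gives the identity after composing with `η X`, hence outright when `η
X` is mono; the general case descends along a cover. This supplies the case `i = j` not contained in
`η_comm`. -/
lemma map_app_eq [F.PreservesEpimorphisms]
    (h : ∀ X : C, ∃ (Q : C) (q : Q ⟶ X), monoLocus η Q ∧ Epi q) (X : C) :
    F.map (η.app X) = η.app (F.obj X) := by
  obtain ⟨Q, q, hQ, _⟩ := h X
  rw [← cancel_epi (F.map (F.map q)), ← F.map_comp]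
  have h1 := η.naturality q
  have h2 := η.naturality (F.map q)
  dsimp at h1 h2
  rw [h1, h2, F.map_comp, map_app_eq_of_monoLocus η hQ]

end MonoLocus

namespace RootDiagram

open Abelian

variable {C : Type u} [Category.{v} C] [Abelian C] {F : C ⥤ C} {η : F ⟶ 𝟭 C} {m : ℕ}

/-- `F (M_i ⟶ M_j)` is the first factor of the cycle `η M_i`, hence mono, and the faithful functor
`F` reflects monomorphisms. -/
lemma mono_map_of_monoLocus [PreservesFiniteLimits F] [F.Faithful] (M : RootDiagram η m)
    {i j : Fin (m + 1)} (h : i ≤ j) (hi : monoLocus η (M.obj i)) : Mono (M.map h) := by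
  have : Mono (η.app (M.obj i)) := hi
  have h1 : F.map (M.map h) ≫ F.map (M.map (Fin.le_last j)) ≫ M.wrap ≫ M.map (Fin.zero_le i) =
      η.app (M.obj i) := by
    rw [← M.cycle i, ← F.map_comp_assoc, map_map]
  rw [← h1] at this
  have : Mono (F.map (M.map h)) := mono_of_mono (F.map (M.map h))
    (F.map (M.map (Fin.le_last j)) ≫ M.wrap ≫ M.map (Fin.zero_le i))
  exact F.mono_of_mono_map this

variable [Abelian (RootDiagram η (m + 1))] [∀ k, PreservesFiniteLimits (ev η (m + 1) k)]
  [∀ k, PreservesFiniteColimits (ev η (m + 1) k)] [PreservesFiniteLimits F]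
  [PreservesFiniteColimits F] [F.Faithful]

/-- This is `gldim = max (gldim C) (gldim (zero locus) + 1)` for `m + 2` objects in a diagram. Two
objects at least are needed for a positive degree in which to put skyscrapers. -/
theorem globalDimensionLT_iff
    (hC : ∀ X : C, ∃ (Q : C) (q : Q ⟶ X), monoLocus η Q ∧ Epi q) (N : ℕ) :
    GlobalDimensionLT (RootDiagram η (m + 1)) N ↔
      GlobalDimensionLT C N ∧ GlobalDimensionLT (zeroLocus η).FullSubcategory (N - 1) := by
  let := HasExt.standard C
  let := HasExt.standard (RootDiagram η (m + 1))
  let := HasExt.standard (zeroLocus η).FullSubcategory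
  have : F.Additive := Functor.additive_of_preserves_binary_products _
  have hcov (k : Fin (m + 1)) (X : RootDiagram η (m + 1)) :
      ∃ (M : RootDiagram η (m + 1)) (q : M ⟶ X), monoAt η k M ∧ Epi q := by
    obtain ⟨M, q, hM, hq⟩ := exists_cover (monoLocus η)
      (show Mono _ from ⟨fun _ _ _ => (F.map_isZero (isZero_zero C)).eq_of_tgt _ _⟩)
      (fun _ _ => monoLocus_biprod η)
      (fun X hX => by
        have : Mono (η.app X) := hX
        change Mono (η.app (F.obj X))
        rw [← map_app_eq_of_monoLocus η hX]
        infer_instance)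
      (map_app_eq η hC) hC X
    exact ⟨M, q, mono_map_of_monoLocus M _ (hM _), hq⟩
  constructor
  · intro h
    refine ⟨h.of_adjunction (constAdjEvZero η (m + 1)), ?_⟩
    rw [_root_.globalDimensionLT_iff]
    intro X Y i hi e
    have hX : monoAt η (Fin.last m) ((sky η (Fin.last m)).obj X) :=
      ⟨fun _ _ _ => (isZero_skyObj (Fin.last m) X.property _ Fin.castSucc_lt_succ.ne).eq_of_tgt _ _⟩
    have key (e' : Ext ((coker η (Fin.last m)).obj ((sky η (Fin.last m)).obj X)) Y i) :
        e' = 0 := by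
      apply ((cokerAdjSky η (Fin.last m)).extMap_bijective (monoAt η (Fin.last m)) (hcov _)
        (fun S hS _ h₃ => shortExact_map_coker _ hS h₃) Y i _ hX).1
      rw [skyLast_ext_eq_zero h X Y (by omega) (Adjunction.extMap _ _ _ _ _),
        skyLast_ext_eq_zero h X Y (by omega) (Adjunction.extMap _ _ _ _ _)]
    -- The counit `coker (sky X) ⟶ X` is invertible because `sky` is fully faithful, so vanishing on
    -- `coker (sky X)` gives vanishing on `X`.
    have h1 : (Ext.mk₀ ((cokerAdjSky η (Fin.last m)).counit.app X)).comp e (zero_add i) = 0 :=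
      key _
    have h2 := congrArg ((Ext.mk₀ (inv ((cokerAdjSky η (Fin.last m)).counit.app X))).comp ·
      (zero_add i)) h1
    simpa using h2
  · rintro ⟨h1, h2⟩
    rw [_root_.globalDimensionLT_iff]
    intro M X i hi e
    refine ext_eq_zero (fun k Y j hj e => ?_) (fun Y e => ext_const_eq_zero h1 M Y hi e) X e
    cases j with
    | zero =>
      -- For `N = 0` the truncated `N - 1` leaves no degree to shift by; but then `C` itself is
      -- zero, and so are all skyscrapers.
      obtain rfl : N = 0 := by omega
      have hY : IsZero Y.obj := by
        let e' : Ext Y.obj Y.obj 0 := Ext.mk₀ (𝟙 _)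
        have h3 : e' = 0 := (_root_.globalDimensionLT_iff 0).1 h1 _ _ 0 le_rfl e'
        rw [IsZero.iff_id_eq_zero]
        exact (Ext.mk₀_eq_zero_iff _).1 h3
      have : IsZero ((sky η k).obj Y) := (sky η k).map_isZero (by
        rw [IsZero.iff_id_eq_zero]
        ext
        exact hY.eq_of_src _ _)
      rw [← e.comp_mk₀_id, this.eq_of_src (𝟙 _) 0, Ext.mk₀_zero, Ext.comp_zero]
    | succ j => exact ext_sky_eq_zero (hcov k) h2 M Y (by omega) e

end RootDiagram

/-! ### Exactness in root categories, tested componentwise -/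

namespace CommutingSystem

open GridIndex

variable {A : Type u} [Category.{v} A] [Abelian A]

namespace Root

section

variable {ι : Type} {D : CommutingSystem A ι} {p : ι → ℕ}

/-- An isomorphism of root objects from componentwise isomorphisms. -/
def isoMk {X Y : D.Root p} (f : X ⟶ Y) (e : ∀ a, X.obj a ≅ Y.obj a)
    (he : ∀ a, (e a).hom = f.app a) : X ≅ Y where
  hom := f
  inv :=
    { app a := (e a).inv
      step h := by
        rw [← cancel_epi (e _).hom, Iso.hom_inv_id_assoc, he, ← reassoc_of% f.step, ← he,
          Iso.hom_inv_id, Category.comp_id]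
      wrap {i _ _} h := by
        rw [← cancel_epi ((D.F i).map (e _).hom), ← Functor.map_comp_assoc, Iso.hom_inv_id,
          CategoryTheory.Functor.map_id, Category.id_comp, he, ← reassoc_of% f.wrap, ← he, Iso.hom_inv_id,
          Category.comp_id] }
  hom_inv_id := by ext a; simp [← he]
  inv_hom_id := by ext a; simp [← he]

/-- The evaluation `M ↦ M_a`. -/
@[reducible]
def ev (D : CommutingSystem A ι) (p : ι → ℕ) (a : GridIndex p) : D.Root p ⥤ A where
  obj X := X.obj a
  map f := f.app a

instance (a : GridIndex p) : (ev D p a).Additive where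

lemma isZero_of_obj {X : D.Root p} (h : ∀ a, IsZero (X.obj a)) : IsZero X := by
  rw [IsZero.iff_id_eq_zero]
  ext a
  exact (h a).eq_of_src _ _

lemma mono_of_app {X Y : D.Root p} (f : X ⟶ Y) (h : ∀ a, Mono (f.app a)) : Mono f :=
  ⟨fun g g' hg => by
    ext a
    have := h a
    rw [← cancel_mono (f.app a), ← comp_app, hg, comp_app]⟩

lemma epi_of_app {X Y : D.Root p} (f : X ⟶ Y) (h : ∀ a, Epi (f.app a)) : Epi f :=
  ⟨fun g g' hg => by
    ext a
    have := h a
    rw [← cancel_epi (f.app a), ← comp_app, hg, comp_app]⟩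

noncomputable instance (a : GridIndex p) : PreservesFiniteLimits (ev D p a) := by
  have {X Y : D.Root p} (f : X ⟶ Y) : PreservesLimit (parallelPair f 0) (ev D p a) :=
    preservesLimit_of_preserves_limit_cone
      (isKernel f (kerι f) (kerι_comp f) (fun _ => inferInstance)
        (fun _ _ k hk => kernel.lift _ k hk) (fun _ _ _ _ => kernel.lift_ι _ _ _))
      ((KernelFork.isLimitMapConeEquiv _ (ev D p a)).symm (kernelIsKernel (f.app a)))
  exact Functor.preservesFiniteLimits_of_preservesKernels _

noncomputable instance (a : GridIndex p) : PreservesFiniteColimits (ev D p a) := by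
  have {X Y : D.Root p} (f : X ⟶ Y) : PreservesColimit (parallelPair f 0) (ev D p a) :=
    preservesColimit_of_preserves_colimit_cocone
      (isCokernel f (cokerπ f) (comp_cokerπ f) (fun _ => inferInstance)
        (fun _ _ k hk => cokernel.desc _ k hk) (fun _ _ _ _ => cokernel.π_desc _ _ _))
      ((CokernelCofork.isColimitMapCoconeEquiv _ (ev D p a)).symm
        (cokernelIsCokernel (f.app a)))
  exact Functor.preservesFiniteColimits_of_preservesCokernels _

/-- Evaluations are exact, so they commute with homology, and an object with zero components is
zero. -/
lemma shortExact_of_ev {S : ShortComplex (D.Root p)} (h : ∀ a, (S.map (ev D p a)).ShortExact) :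
    S.ShortExact := by
  have : Mono S.f := mono_of_app _ fun a => (h a).mono_f
  have : Epi S.g := epi_of_app _ fun a => (h a).epi_g
  refine { exact := ?_ }
  rw [ShortComplex.exact_iff_isZero_homology]
  refine isZero_of_obj fun a => ?_
  exact ((ShortComplex.exact_iff_isZero_homology _).1 (h a).exact).of_iso
    (S.mapHomologyIso (ev D p a)).symm

/-- A functor to a category of root objects is exact if its components are exact. -/
lemma exact_of_comp_ev {B : Type*} [Category* B] [Abelian B] (G : B ⥤ D.Root p)
    (hl : ∀ a, PreservesFiniteLimits (G ⋙ ev D p a))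
    (hr : ∀ a, PreservesFiniteColimits (G ⋙ ev D p a)) :
    PreservesFiniteLimits G ∧ PreservesFiniteColimits G := by
  have hadd (a) : (G ⋙ ev D p a).Additive := Functor.additive_of_preserves_binary_products _
  have : G.Additive := ⟨fun {X Y f g} => by
    ext a
    exact (G ⋙ ev D p a).map_add (f := f) (g := g)⟩
  have key : (∀ S : ShortComplex _, S.ShortExact → (S.map G).ShortExact) ↔
      PreservesFiniteLimits G ∧ PreservesFiniteColimits G := (Functor.exact_tfae G).out 0 3
  refine key.1 fun S hS => shortExact_of_ev fun a => ?_
  exact hS.map_of_exact (G ⋙ ev D p a)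

end

end Root

end CommutingSystem

/-! ### The first functor acting on root objects of the others; restriction to subcategories -/

namespace CommutingSystem

open GridIndex

variable {A : Type u} [Category.{v} A] [Abelian A]

/-- The system of all functors but the first one. -/
@[reducible]
def tail {n : ℕ} (D : CommutingSystem A (Fin (n + 1))) : CommutingSystem A (Fin n) where
  F i := D.F i.succ
  leftExact i := D.leftExact i.succ
  rightExact i := D.rightExact i.succ
  comm i j := D.comm i.succ j.succ
  comm_self i := D.comm_self i.succ
  comm_symm i j := D.comm_symm i.succ j.succ
  comm_coherence i j k := D.comm_coherence i.succ j.succ k.succ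
  η i := D.η i.succ
  η_comm i j h := D.η_comm i.succ j.succ (fun h' => h (Fin.succ_injective _ h'))

section Lift

variable {n : ℕ} (D : CommutingSystem A (Fin (n + 1))) (p : Fin n → ℕ)

/-- Naturality of `η 0` combined with its compatibility with `F j`. It says that `η 0`, applied
componentwise, respects the wraps. -/
lemma η_tail_naturality (j : Fin n) {X Y : A} (w : (D.F j.succ).obj X ⟶ Y) :
    ((D.comm 0 j.succ).hom.app X ≫ (D.F 0).map w) ≫ (D.η 0).app Y =
      (D.F j.succ).map ((D.η 0).app X) ≫ w := by
  have h := (D.η 0).naturality w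
  dsimp at h
  rw [Category.assoc, h, D.η_comm 0 j.succ (Fin.succ_ne_zero j).symm, Category.assoc]

/-- The functor `F 0`, applied componentwise to a grid. -/
@[reducible]
def liftGrid (X : D.tail.PreGrid p) : D.tail.PreGrid p where
  obj a := (D.F 0).obj (X.obj a)
  step h := (D.F 0).map (X.step h)
  wrap {j _ _} h := (D.comm 0 j.succ).hom.app _ ≫ (D.F 0).map (X.wrap h)

variable {D p} in
lemma exists_isPath_of_liftGrid {X : D.tail.PreGrid p} {i : Fin n} {a b : GridIndex p}
    {u : (D.liftGrid p X).obj a ⟶ (D.liftGrid p X).obj b} (hu : IsPath (D.liftGrid p X) i a b u) :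
    ∃ u', IsPath X i a b u' ∧ u = (D.F 0).map u' := by
  induction hu with
  | refl => exact ⟨_, .refl, ((D.F 0).map_id _).symm⟩
  | step _ h ih =>
    obtain ⟨u', h1, rfl⟩ := ih
    exact ⟨_, .step h1 h, ((D.F 0).map_comp _ _).symm⟩

/-- The functor `F 0`, applied componentwise, on objects. -/
@[reducible]
def liftObj (X : D.tail.Root p) : D.tail.Root p where
  toPreGrid := D.liftGrid p X.toPreGrid
  step_step hab hbd hac hcd := by
    rw [← Functor.map_comp, X.step_step hab hbd hac hcd, Functor.map_comp]
  wrap_step {j _ a _ c _} hab hbd hac hcd := by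
    have h := (D.comm 0 j.succ).hom.naturality (X.step hac)
    dsimp at h
    rw [Category.assoc, ← Functor.map_comp, X.wrap_step hab hbd hac hcd, Functor.map_comp,
      reassoc_of% h]
  wrap_wrap {i j a b c d} hab hbd hac hcd := by
    have h1 := (D.comm 0 j.succ).hom.naturality (X.wrap hab)
    have h2 := (D.comm 0 i.succ).hom.naturality (X.wrap hac)
    -- Moving `F 0` past both wraps in the two possible orders gives the two sides of the coherence
    -- condition.
    have h3 := D.comm_coherence 0 i.succ j.succ (X.obj a)
    have h4 := X.wrap_wrap hab hbd hac hcd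
    dsimp at h1 h2 h3 h4 ⊢
    simp only [Functor.map_comp, Category.assoc]
    rw [reassoc_of% h1, ← Functor.map_comp, h4, reassoc_of% h2]
    simp only [Functor.map_comp]
    rw [reassoc_of% h3]
  cycle {j a b c u w} hu h hw := by
    obtain ⟨u', hu', rfl⟩ := exists_isPath_of_liftGrid hu
    obtain ⟨w', hw', rfl⟩ := exists_isPath_of_liftGrid hw
    have h1 := (D.comm 0 j.succ).hom.naturality u'
    have h2 := X.cycle hu' h hw'
    -- `F 0` of a cycle is `F 0 (η j)`, which becomes `η j` at `F 0 X` once the commutation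
    -- isomorphism is cancelled against its inverse.
    have h3 := D.η_comm j.succ 0 (Fin.succ_ne_zero j) (X.obj a)
    have h4 := D.comm_symm 0 j.succ (X.obj a)
    dsimp at h1 h2 h3 h4 ⊢
    rw [Category.assoc, reassoc_of% h1, ← Functor.map_comp, ← Functor.map_comp, h2, h3,
      reassoc_of% h4]

/-- The functor `F 0`, applied componentwise. -/
@[reducible]
def lift : D.tail.Root p ⥤ D.tail.Root p where
  obj X := D.liftObj p X
  map {X Y} f :=
    { app a := (D.F 0).map (f.app a)
      step h := by
        dsimp only
        rw [← Functor.map_comp, f.step, Functor.map_comp]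
      wrap {j a b} h := by
        have h1 := (D.comm 0 j.succ).hom.naturality (f.app a)
        have h2 := f.wrap h
        dsimp at h1 h2 ⊢
        rw [Category.assoc, ← Functor.map_comp, h2, reassoc_of% h1, Functor.map_comp] }
  map_id X := by ext a; exact (D.F 0).map_id _
  map_comp f g := by ext a; exact (D.F 0).map_comp _ _

/-- The natural transformation `η 0`, applied componentwise. -/
@[reducible]
def liftη : D.lift p ⟶ 𝟭 (D.tail.Root p) where
  app X :=
    { app a := (D.η 0).app (X.obj a)
      step h := (D.η 0).naturality _
      wrap h := D.η_tail_naturality _ _ }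
  naturality X Y f := by ext a; exact (D.η 0).naturality _

instance [(D.F 0).Faithful] : (D.lift p).Faithful where
  map_injective h := Root.hom_ext fun a =>
    (D.F 0).map_injective (congrArg (fun f => PreGrid.Hom.app f a) h)

lemma lift_exact : PreservesFiniteLimits (D.lift p) ∧ PreservesFiniteColimits (D.lift p) :=
  Root.exact_of_comp_ev _
    (fun a => inferInstanceAs (PreservesFiniteLimits (Root.ev D.tail p a ⋙ D.F 0)))
    (fun a => inferInstanceAs (PreservesFiniteColimits (Root.ev D.tail p a ⋙ D.F 0)))

instance : PreservesFiniteLimits (D.lift p) := (D.lift_exact p).1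
instance : PreservesFiniteColimits (D.lift p) := (D.lift_exact p).2

end Lift

lemma _root_.CategoryTheory.ObjectProperty.ι_exact (P : ObjectProperty A) [P.ContainsZero]
    [P.IsClosedUnderSubobjects] [P.IsClosedUnderQuotients] [P.IsClosedUnderFiniteProducts] :
    PreservesFiniteLimits P.ι ∧ PreservesFiniteColimits P.ι := by
  have := P.preservesKernels_ι
  have := P.preservesCokernels_ι
  exact ⟨Functor.preservesFiniteLimits_of_preservesKernels _,
    Functor.preservesFiniteColimits_of_preservesCokernels _⟩

section Restrict

variable {ι : Type} (D : CommutingSystem A ι) (P : ObjectProperty A) [P.ContainsZero]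
  [P.IsClosedUnderSubobjects] [P.IsClosedUnderQuotients] [P.IsClosedUnderFiniteProducts]

variable {P}

/-- The inclusion of the subcategory is exact and reflects short exactness, so exactness can be
checked after applying it, where the functor is `G`. -/
lemma restrictF_exact {G : A ⥤ A} [PreservesFiniteLimits G] [PreservesFiniteColimits G]
    (hP : ∀ X, P X → P (G.obj X)) :
    PreservesFiniteLimits (P.lift (P.ι ⋙ G) fun X => hP _ X.property) ∧
      PreservesFiniteColimits (P.lift (P.ι ⋙ G) fun X => hP _ X.property) := by
  have h := P.ι_exact
  have := h.1
  have := h.2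
  have h1 : (P.ι ⋙ G).Additive := Functor.additive_of_preserves_binary_products _
  have : (P.lift (P.ι ⋙ G) fun X => hP _ X.property).Additive :=
    ⟨fun {X Y f g} => by
      ext
      exact h1.map_add (f := f) (g := g)⟩
  have key : (∀ S : ShortComplex _, S.ShortExact →
      (S.map (P.lift (P.ι ⋙ G) fun X => hP _ X.property)).ShortExact) ↔
      PreservesFiniteLimits (P.lift (P.ι ⋙ G) fun X => hP _ X.property) ∧
      PreservesFiniteColimits (P.lift (P.ι ⋙ G) fun X => hP _ X.property) :=
    (Functor.exact_tfae _).out 0 3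
  refine key.1 fun S hS => ?_
  have h3 := hS.map_of_exact (P.ι ⋙ G)
  have := h3.mono_f
  have := h3.epi_g
  exact { exact := Functor.reflects_exact_of_faithful P.ι _ h3.exact
          mono_f := P.ι.mono_of_mono_map (by assumption)
          epi_g := P.ι.epi_of_epi_map (by assumption) }

/-- The restriction to a full subcategory which is stable under all functors. -/
@[reducible]
def restrict (hP : ∀ i X, P X → P ((D.F i).obj X)) : CommutingSystem P.FullSubcategory ι where
  F i := P.lift (P.ι ⋙ D.F i) fun X => hP i _ X.property
  leftExact i := (restrictF_exact (hP i)).1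
  rightExact i := (restrictF_exact (hP i)).2
  comm i j := NatIso.ofComponents (fun X => P.isoMk ((D.comm i j).app X.obj))
    (fun f => by ext; exact (D.comm i j).hom.naturality f.hom)
  comm_self i := by
    ext X
    have := congrArg (fun e => e.hom.app X.obj) (D.comm_self i)
    exact this
  comm_symm i j X := by ext; exact D.comm_symm i j X.obj
  comm_coherence i j k X := by ext; exact D.comm_coherence i j k X.obj
  η i := { app X := ObjectProperty.homMk ((D.η i).app X.obj)
           naturality X Y f := by ext; exact (D.η i).naturality f.hom }
  η_comm i j h X := by ext; exact D.η_comm i j h X.obj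

end Restrict

end CommutingSystem

/-! ### Splitting off the first coordinate of an index -/

namespace GridIndex

variable {n m : ℕ} {p : Fin n → ℕ}

/-- The shape `{1, …, m + 1} × {1, …, p_1} × ⋯ × {1, …, p_n}`. -/
abbrev consShape (m : ℕ) (p : Fin n → ℕ) : Fin (n + 1) → ℕ := Fin.cons (m + 1) p

/-- The index with given first coordinate and given other coordinates. -/
def cons (k : Fin (m + 1)) (a : GridIndex p) : GridIndex (consShape m p) :=
  Fin.cons (α := fun i => Fin (consShape m p i)) k a

/-- The first coordinate. -/
def head (a : GridIndex (consShape m p)) : Fin (m + 1) := a 0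

/-- The other coordinates. -/
def others (a : GridIndex (consShape m p)) : GridIndex p := fun j => a j.succ

lemma exists_cons (a : GridIndex (consShape m p)) : ∃ k b, a = cons k b :=
  ⟨head a, others a, (Fin.cons_self_tail (α := fun i => Fin (consShape m p i)) a).symm⟩

lemma cons_head_others (a : GridIndex (consShape m p)) : cons (head a) (others a) = a :=
  Fin.cons_self_tail (α := fun i => Fin (consShape m p i)) a

lemma head_others_ext {a b : GridIndex (consShape m p)} (h : head a = head b)
    (h' : others a = others b) : a = b := by
  rw [← cons_head_others a, h, h', cons_head_others]

lemma step_zero_iff {a b : GridIndex (consShape m p)} :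
    Step 0 a b ↔ (head b).val = (head a).val + 1 ∧ others a = others b := by
  refine and_congr Iff.rfl ⟨fun h => funext fun j => h _ (Fin.succ_ne_zero j), fun h j hj => ?_⟩
  obtain ⟨j, rfl⟩ := Fin.exists_succ_eq_of_ne_zero hj
  exact congrFun h j

lemma wrap_zero_iff {a b : GridIndex (consShape m p)} :
    Wrap 0 a b ↔ head a = Fin.last m ∧ head b = 0 ∧ others a = others b := by
  have h1 : (head a).val + 1 = m + 1 ↔ head a = Fin.last m := by
    rw [Fin.ext_iff, Fin.val_last]; omega
  have h2 : (head b).val = 0 ↔ head b = 0 := by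
    rw [Fin.ext_iff, Fin.val_zero]
  refine and_congr h1 (and_congr h2
    ⟨fun h => funext fun j => h _ (Fin.succ_ne_zero j), fun h j hj => ?_⟩)
  obtain ⟨j, rfl⟩ := Fin.exists_succ_eq_of_ne_zero hj
  exact congrFun h j

lemma forall_ne_succ_iff {i : Fin n} {a b : GridIndex (consShape m p)} :
    (∀ j, j ≠ i.succ → a j = b j) ↔ head a = head b ∧ ∀ j, j ≠ i → others a j = others b j := by
  refine ⟨fun h => ⟨h 0 (Fin.succ_ne_zero i).symm,
    fun j hj => h j.succ fun h' => hj (Fin.succ_injective _ h')⟩, fun h j hj => ?_⟩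
  cases j using Fin.cases with
  | zero => exact h.1
  | succ j => exact h.2 j fun h' => hj (congrArg Fin.succ h')

lemma step_succ_iff {i : Fin n} {a b : GridIndex (consShape m p)} :
    Step i.succ a b ↔ head a = head b ∧ Step i (others a) (others b) := by
  unfold Step
  rw [forall_ne_succ_iff]
  exact and_left_comm

lemma wrap_succ_iff {i : Fin n} {a b : GridIndex (consShape m p)} :
    Wrap i.succ a b ↔ head a = head b ∧ Wrap i (others a) (others b) := by
  unfold Wrap
  rw [forall_ne_succ_iff]
  constructor
  · rintro ⟨h1, h2, h3, h4⟩
    exact ⟨h3, h1, h2, h4⟩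
  · rintro ⟨h3, h1, h2, h4⟩
    exact ⟨h1, h2, h3, h4⟩

end GridIndex

/-! ### Assembling a grid from a diagram of slices -/

namespace CommutingSystem

open GridIndex

variable {A : Type u} [Category.{v} A] [Abelian A] {n : ℕ} {D : CommutingSystem A (Fin (n + 1))}
  {m : ℕ} {p : Fin n → ℕ}

lemma Root.eqToHom_app {ι : Type} {E : CommutingSystem A ι} {q : ι → ℕ} {X Y : E.Root q}
    (f : X ⟶ Y) {a b : GridIndex q} (e : a = b) :
    eqToHom (congrArg X.obj e) ≫ f.app b = f.app a ≫ eqToHom (congrArg Y.obj e) := by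
  subst e
  simp

section Laws

variable (M : RootDiagram (D.liftη p) m) {k l r s : Fin (m + 1)} {a b c d : GridIndex p}

lemma map_app_map_app (hkl : k ≤ l) (hlr : l ≤ r) (a : GridIndex p) :
    (M.map hkl).app a ≫ (M.map hlr).app a = (M.map (hkl.trans hlr)).app a :=
  congrArg (fun f => PreGrid.Hom.app f a) (M.map_map hkl hlr)

lemma map_app_self (h : k ≤ k) (a : GridIndex p) : (M.map h).app a = 𝟙 _ :=
  congrArg (fun f => PreGrid.Hom.app f a) (M.map_self h)

lemma cycle_app (k : Fin (m + 1)) (a : GridIndex p) :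
    (D.F 0).map ((M.map (Fin.le_last k)).app a) ≫ M.wrap.app a ≫ (M.map (Fin.zero_le k)).app a =
      (D.η 0).app ((M.obj k).obj a) :=
  congrArg (fun f => PreGrid.Hom.app f a) (M.cycle k)

lemma wrap_app_wrap {j : Fin n} (h : Wrap j a b) :
    (D.F j.succ).map (M.wrap.app a) ≫ (M.obj 0).wrap h = ((D.comm 0 j.succ).hom.app _ ≫
      (D.F 0).map ((M.obj (Fin.last m)).wrap h)) ≫ M.wrap.app b :=
  (M.wrap.wrap h).symm

lemma wrap_app_step {j : Fin n} (h : Step j a b) :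
    M.wrap.app a ≫ (M.obj 0).step h = (D.F 0).map ((M.obj (Fin.last m)).step h) ≫ M.wrap.app b :=
  (M.wrap.step h).symm

/-- This law and the ones that follow are stated for free indices, with inequalities between first
coordinates and equations between the others, so that the equations can be eliminated before any
object depends on them. -/
lemma unslice_step_step_zero_succ {j : Fin n} (hkl : k ≤ l) (hls : l ≤ s) (hkr : k ≤ r)
    (hrs : r ≤ s) (e : a = b) (e' : c = d) (h : Step j a c) (h' : Step j b d) :
    ((M.map hkl).app a ≫ eqToHom (congrArg (M.obj l).obj e)) ≫
        (M.obj l).step h' ≫ (M.map hls).app d =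
      ((M.obj k).step h ≫ (M.map hkr).app c) ≫
        (M.map hrs).app c ≫ eqToHom (congrArg (M.obj s).obj e') := by
  subst e e'
  simp only [eqToHom_refl, Category.comp_id, Category.assoc, map_app_map_app]
  rw [← reassoc_of% (M.map hkl).step, map_app_map_app]

lemma unslice_step_step_succ_succ {i j : Fin n} (hkl : k ≤ l) (hls : l ≤ s) (hkr : k ≤ r)
    (hrs : r ≤ s) (hab : Step i a b) (hbd : Step j b d) (hac : Step j a c) (hcd : Step i c d) :
    ((M.obj k).step hab ≫ (M.map hkl).app b) ≫ (M.obj l).step hbd ≫ (M.map hls).app d =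
      ((M.obj k).step hac ≫ (M.map hkr).app c) ≫ (M.obj r).step hcd ≫ (M.map hrs).app d := by
  simp only [Category.assoc]
  rw [← reassoc_of% (M.map hkl).step, ← reassoc_of% (M.map hkr).step, map_app_map_app,
    map_app_map_app, reassoc_of% (M.obj k).step_step hab hbd hac hcd]

lemma unslice_wrap_step_zero_succ {j : Fin n} (hls : l ≤ s) (hkr : k ≤ r)
    (e : a = b) (e' : c = d) (h : Step j a c) (h' : Step j b d) :
    ((D.F 0).map ((M.map (Fin.le_last k)).app a) ≫ M.wrap.app a ≫ (M.map (Fin.zero_le l)).app a ≫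
        eqToHom (congrArg (M.obj l).obj e)) ≫ (M.obj l).step h' ≫ (M.map hls).app d =
      (D.F 0).map ((M.obj k).step h ≫ (M.map hkr).app c) ≫
        (D.F 0).map ((M.map (Fin.le_last r)).app c) ≫ M.wrap.app c ≫
          (M.map (Fin.zero_le s)).app c ≫ eqToHom (congrArg (M.obj s).obj e') := by
  subst e e'
  simp only [eqToHom_refl, Category.comp_id, Category.assoc]
  rw [← reassoc_of% (M.map (Fin.zero_le l)).step, map_app_map_app, reassoc_of% wrap_app_step,
    ← Functor.map_comp_assoc, ← Functor.map_comp_assoc, Category.assoc, map_app_map_app,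
    (M.map (Fin.le_last k)).step]

lemma unslice_wrap_step_succ_zero {i : Fin n} (hkl : k ≤ l) (hls : l ≤ s) (hkr : k ≤ r)
    (hrs : r ≤ s) (e : a = c) (e' : b = d) (h : Wrap i a b) (h' : Wrap i c d) :
    ((M.obj k).wrap h ≫ (M.map hkl).app b) ≫
        (M.map hls).app b ≫ eqToHom (congrArg (M.obj s).obj e') =
      (D.F i.succ).map ((M.map hkr).app a ≫ eqToHom (congrArg (M.obj r).obj e)) ≫
        (M.obj r).wrap h' ≫ (M.map hrs).app d := by
  subst e e'
  simp only [eqToHom_refl, Category.comp_id, Category.assoc, map_app_map_app]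
  rw [← reassoc_of% (M.map hkr).wrap, map_app_map_app]

lemma unslice_wrap_step_succ_succ {i j : Fin n} (hkl : k ≤ l) (hls : l ≤ s) (hkr : k ≤ r)
    (hrs : r ≤ s) (hab : Wrap i a b) (hbd : Step j b d) (hac : Step j a c) (hcd : Wrap i c d) :
    ((M.obj k).wrap hab ≫ (M.map hkl).app b) ≫ (M.obj l).step hbd ≫ (M.map hls).app d =
      (D.F i.succ).map ((M.obj k).step hac ≫ (M.map hkr).app c) ≫
        (M.obj r).wrap hcd ≫ (M.map hrs).app d := by
  simp only [Category.assoc]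
  rw [← reassoc_of% (M.map hkl).step, Functor.map_comp_assoc, ← reassoc_of% (M.map hkr).wrap,
    map_app_map_app, map_app_map_app, reassoc_of% (M.obj k).wrap_step hab hbd hac hcd]

lemma unslice_wrap_wrap_zero_succ {j : Fin n} (hls : l ≤ s) (hkr : k ≤ r)
    (e : a = b) (e' : c = d) (h : Wrap j a c) (h' : Wrap j b d) :
    (D.F j.succ).map ((D.F 0).map ((M.map (Fin.le_last k)).app a) ≫ M.wrap.app a ≫
        (M.map (Fin.zero_le l)).app a ≫ eqToHom (congrArg (M.obj l).obj e)) ≫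
          (M.obj l).wrap h' ≫ (M.map hls).app d =
      (D.comm 0 j.succ).hom.app _ ≫ (D.F 0).map ((M.obj k).wrap h ≫ (M.map hkr).app c) ≫
        (D.F 0).map ((M.map (Fin.le_last r)).app c) ≫ M.wrap.app c ≫
          (M.map (Fin.zero_le s)).app c ≫ eqToHom (congrArg (M.obj s).obj e') := by
  subst e e'
  have h1 := (D.comm 0 j.succ).hom.naturality ((M.map (Fin.le_last k)).app a)
  have h2 := (M.map (Fin.le_last k)).wrap h
  have h3 := (M.map (Fin.zero_le l)).wrap h
  have h4 := wrap_app_wrap M h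
  dsimp at h1 h2 h3 h4
  simp only [eqToHom_refl, Category.comp_id, Functor.map_comp_assoc]
  rw [← reassoc_of% h3, map_app_map_app, reassoc_of% h4, reassoc_of% h1,
    ← Functor.map_comp_assoc, ← h2, ← Functor.map_comp_assoc, ← Functor.map_comp_assoc,
    Category.assoc, map_app_map_app]

lemma unslice_wrap_wrap_succ_succ {i j : Fin n} (hkl : k ≤ l) (hls : l ≤ s) (hkr : k ≤ r)
    (hrs : r ≤ s) (hab : Wrap i a b) (hbd : Wrap j b d) (hac : Wrap j a c) (hcd : Wrap i c d) :
    (D.F j.succ).map ((M.obj k).wrap hab ≫ (M.map hkl).app b) ≫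
        (M.obj l).wrap hbd ≫ (M.map hls).app d =
      (D.comm i.succ j.succ).hom.app _ ≫
        (D.F i.succ).map ((M.obj k).wrap hac ≫ (M.map hkr).app c) ≫
          (M.obj r).wrap hcd ≫ (M.map hrs).app d := by
  have h1 := (M.map hkl).wrap hbd
  have h2 := (M.map hkr).wrap hcd
  have h3 := (M.obj k).wrap_wrap hab hbd hac hcd
  dsimp at h1 h2 h3
  rw [Functor.map_comp_assoc, ← reassoc_of% h1, Functor.map_comp_assoc, ← reassoc_of% h2,
    map_app_map_app, map_app_map_app, reassoc_of% h3]

lemma unslice_cycle_zero (hkl : k ≤ l) (hrk : r ≤ k) (e : a = b) (e' : b = c) (e'' : c = a) :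
    (D.F 0).map ((M.map hkl).app a ≫ eqToHom (congrArg (M.obj l).obj e)) ≫
        ((D.F 0).map ((M.map (Fin.le_last l)).app b) ≫ M.wrap.app b ≫
          (M.map (Fin.zero_le r)).app b ≫ eqToHom (congrArg (M.obj r).obj e')) ≫
            (M.map hrk).app c ≫ eqToHom (congrArg (M.obj k).obj e'') =
      (D.η 0).app ((M.obj k).obj a) := by
  subst e e'
  simp only [eqToHom_refl, Category.comp_id, Category.assoc]
  rw [map_app_map_app, ← Functor.map_comp_assoc, map_app_map_app, cycle_app]

lemma unslice_cycle_succ {i : Fin n} (hkl : k ≤ l) (hlr : l ≤ r) (hrk : r ≤ k)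
    {u : (M.obj k).obj a ⟶ (M.obj k).obj b} {w : (M.obj r).obj c ⟶ (M.obj r).obj a}
    (hu : IsPath (M.obj k).toPreGrid i a b u) (h : Wrap i b c)
    (hw : IsPath (M.obj r).toPreGrid i c a w) :
    (D.F i.succ).map (u ≫ (M.map hkl).app b) ≫ ((M.obj l).wrap h ≫ (M.map hlr).app c) ≫
        w ≫ (M.map hrk).app a = (D.η i.succ).app ((M.obj k).obj a) := by
  obtain rfl := le_antisymm (hkl.trans hlr) hrk
  obtain rfl := le_antisymm hkl hlr
  simp only [map_app_self, Category.comp_id]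
  exact (M.obj k).cycle hu h hw

end Laws

/-- The grid with slices `M.obj k`. -/
@[reducible]
def unsliceGrid (M : RootDiagram (D.liftη p) m) : D.PreGrid (consShape m p) where
  obj a := (M.obj (head a)).obj (others a)
  step {i a b} h := Fin.cases (motive := fun i => Step i a b →
      ((M.obj (head a)).obj (others a) ⟶ (M.obj (head b)).obj (others b)))
    (fun h => (M.map (show head a ≤ head b from by
        have := (step_zero_iff.1 h).1
        rw [Fin.le_def]; omega)).app (others a) ≫
      eqToHom (congrArg (M.obj (head b)).obj (step_zero_iff.1 h).2))
    -- The two heads are equal, and the transition `M.map` along the resulting inequality is an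
    -- identity; using it in place of a transport lets functoriality of `M` do the bookkeeping.
    (fun _ h => (M.obj (head a)).step (step_succ_iff.1 h).2 ≫
      (M.map (step_succ_iff.1 h).1.le).app (others b)) i h
  wrap {i a b} h := Fin.cases (motive := fun i => Wrap i a b →
      ((D.F i).obj ((M.obj (head a)).obj (others a)) ⟶ (M.obj (head b)).obj (others b)))
    (fun h => (D.F 0).map ((M.map (Fin.le_last (head a))).app (others a)) ≫
      M.wrap.app (others a) ≫ (M.map (Fin.zero_le (head b))).app (others a) ≫
      eqToHom (congrArg (M.obj (head b)).obj (wrap_zero_iff.1 h).2.2))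
    (fun _ h => (M.obj (head a)).wrap (wrap_succ_iff.1 h).2 ≫
      (M.map (wrap_succ_iff.1 h).1.le).app (others b)) i h

section

variable (M : RootDiagram (D.liftη p) m)

lemma exists_of_isPath_zero {a b : GridIndex (consShape m p)}
    {u : (unsliceGrid M).obj a ⟶ (unsliceGrid M).obj b} (hu : IsPath (unsliceGrid M) 0 a b u) :
    ∃ (h : head a ≤ head b) (e : others a = others b),
      u = (M.map h).app (others a) ≫ eqToHom (congrArg (M.obj (head b)).obj e) := by
  induction hu with
  | refl => exact ⟨le_rfl, rfl, by rw [map_app_self, eqToHom_refl, Category.comp_id]⟩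
  | @step b c u hu h ih =>
    obtain ⟨h1, e, rfl⟩ := ih
    obtain ⟨h2, e'⟩ := step_zero_iff.1 h
    have h3 : head b ≤ head c := by rw [Fin.le_def]; omega
    refine ⟨h1.trans h3, e.trans e', ?_⟩
    change (_ ≫ _) ≫ (M.map h3).app (others b) ≫ eqToHom _ = _
    rw [Category.assoc, reassoc_of% Root.eqToHom_app (M.map h3) e, eqToHom_trans, ← Category.assoc,
      map_app_map_app]

lemma exists_of_isPath_succ {i : Fin n} {a b : GridIndex (consShape m p)}
    {u : (unsliceGrid M).obj a ⟶ (unsliceGrid M).obj b}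
    (hu : IsPath (unsliceGrid M) i.succ a b u) :
    ∃ (h : head a ≤ head b)
      (u' : (M.obj (head a)).obj (others a) ⟶ (M.obj (head a)).obj (others b)),
      IsPath (M.obj (head a)).toPreGrid i (others a) (others b) u' ∧
      u = u' ≫ (M.map h).app (others b) := by
  induction hu with
  | refl => exact ⟨le_rfl, _, .refl, by rw [map_app_self, Category.comp_id]⟩
  | @step b c u hu h ih =>
    obtain ⟨h1, u', hu', rfl⟩ := ih
    obtain ⟨h2, h3⟩ := step_succ_iff.1 h
    refine ⟨h1.trans h2.le, _, .step hu' h3, ?_⟩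
    change (_ ≫ _) ≫ (M.obj (head b)).step h3 ≫ (M.map h2.le).app (others c) = _
    rw [Category.assoc, ← reassoc_of% (M.map h1).step, map_app_map_app, Category.assoc]

/-- The root object with slices `M.obj k`. -/
@[reducible]
def unsliceObj : D.Root (consShape m p) where
  toPreGrid := unsliceGrid M
  step_step {i j a b c d} hab hbd hac hcd := by
    cases i using Fin.cases with
    | zero =>
      cases j using Fin.cases with
      | zero =>
        obtain rfl : b = c := by
          rw [step_zero_iff] at hab hac
          exact head_others_ext (Fin.ext (by omega)) (hab.2.symm.trans hac.2)
        rfl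
      | succ j =>
        exact unslice_step_step_zero_succ M _ _ _ _ (step_zero_iff.1 hab).2
          (step_zero_iff.1 hcd).2 _ _
    | succ i =>
      cases j using Fin.cases with
      | zero =>
        exact (unslice_step_step_zero_succ M _ _ _ _ (step_zero_iff.1 hac).2
          (step_zero_iff.1 hbd).2 _ _).symm
      | succ j => exact unslice_step_step_succ_succ M _ _ _ _ _ _ _ _
  wrap_step {i j a b c d} hab hbd hac hcd := by
    cases i using Fin.cases with
    | zero =>
      cases j using Fin.cases with
      | zero =>
        -- Impossible case: a wrap starts at the last value of the first coordinate, from which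
        -- there is no further step.
        rw [wrap_zero_iff] at hab
        rw [step_zero_iff, hab.1, Fin.val_last] at hac
        exact absurd (head c).isLt (by omega)
      | succ j =>
        exact unslice_wrap_step_zero_succ M _ _ (wrap_zero_iff.1 hab).2.2 (wrap_zero_iff.1 hcd).2.2 _ _
    | succ i =>
      cases j using Fin.cases with
      | zero =>
        exact unslice_wrap_step_succ_zero M _ _ _ _ (step_zero_iff.1 hac).2
          (step_zero_iff.1 hbd).2 _ _
      | succ j => exact unslice_wrap_step_succ_succ M _ _ _ _ _ _ _ _
  wrap_wrap {i j a b c d} hab hbd hac hcd := by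
    cases i using Fin.cases with
    | zero =>
      cases j using Fin.cases with
      | zero =>
        obtain rfl : b = c := by
          rw [wrap_zero_iff] at hab hac
          exact head_others_ext (hab.2.1.trans hac.2.1.symm) (hab.2.2.symm.trans hac.2.2)
        -- Both composites are literally the same, so the law reduces to `comm 0 0` being the
        -- identity.
        rw [D.comm_self]
        exact (Category.id_comp _).symm
      | succ j =>
        exact unslice_wrap_wrap_zero_succ M _ _ (wrap_zero_iff.1 hab).2.2 (wrap_zero_iff.1 hcd).2.2 _ _
    | succ i =>
      cases j using Fin.cases with
      | zero =>
        -- This is the previous law with the two directions exchanged, read through the inverse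
        -- commutation isomorphism.
        have := unslice_wrap_wrap_zero_succ M (wrap_succ_iff.1 hcd).1.le (wrap_succ_iff.1 hab).1.le
          (wrap_zero_iff.1 hac).2.2 (wrap_zero_iff.1 hbd).2.2 (wrap_succ_iff.1 hab).2
          (wrap_succ_iff.1 hcd).2
        refine Eq.trans ?_ (congrArg ((D.comm i.succ 0).hom.app _ ≫ ·) this.symm)
        rw [reassoc_of% D.comm_symm i.succ 0]
        rfl
      | succ j => exact unslice_wrap_wrap_succ_succ M _ _ _ _ _ _ _ _
  cycle {i a b c u w} hu h hw := by
    cases i using Fin.cases with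
    | zero =>
      obtain ⟨h1, e1, rfl⟩ := exists_of_isPath_zero M hu
      obtain ⟨h2, e2, rfl⟩ := exists_of_isPath_zero M hw
      exact unslice_cycle_zero M _ _ e1 (wrap_zero_iff.1 h).2.2 e2
    | succ i =>
      obtain ⟨h1, u, hu', rfl⟩ := exists_of_isPath_succ M hu
      obtain ⟨h2, w, hw', rfl⟩ := exists_of_isPath_succ M hw
      exact unslice_cycle_succ M _ _ _ hu' _ hw'

end

end CommutingSystem

namespace RootDiagram

variable {C : Type u} [Category.{v} C] {F : C ⥤ C} {η : F ⟶ 𝟭 C} {m : ℕ}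

lemma naturality_of_castSucc_le_succ {X Y : RootDiagram η m} (f : ∀ k, X.obj k ⟶ Y.obj k)
    (h : ∀ k : Fin m, X.map k.castSucc_le_succ ≫ f k.succ =
      f k.castSucc ≫ Y.map k.castSucc_le_succ) {i j : Fin (m + 1)} (hij : i ≤ j) :
    X.map hij ≫ f j = f i ≫ Y.map hij := by
  induction j using Fin.induction with
  | zero =>
    obtain rfl := le_antisymm hij (Fin.zero_le i)
    simp
  | succ j ih =>
    obtain rfl | hij' := eq_or_lt_of_le hij
    · simp
    · have h' : i ≤ j.castSucc := Fin.le_castSucc_iff.2 hij'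
      rw [← X.map_map h' j.castSucc_le_succ, ← Y.map_map h' j.castSucc_le_succ, Category.assoc, h,
        ← Category.assoc, ih, Category.assoc]

end RootDiagram

namespace GridIndex

variable {n m : ℕ} {p : Fin n → ℕ} {a b : GridIndex p}

lemma step_cons_zero (k : Fin m) (a : GridIndex p) :
    Step 0 (cons k.castSucc a) (cons k.succ a) :=
  step_zero_iff.2 ⟨rfl, rfl⟩

lemma step_cons_succ (k : Fin (m + 1)) {i : Fin n} (h : Step i a b) :
    Step i.succ (cons k a) (cons k b) :=
  step_succ_iff.2 ⟨rfl, h⟩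

lemma wrap_cons_zero (a : GridIndex p) : Wrap 0 (cons (Fin.last m) a) (cons 0 a) :=
  wrap_zero_iff.2 ⟨rfl, rfl, rfl⟩

lemma wrap_cons_succ (k : Fin (m + 1)) {i : Fin n} (h : Wrap i a b) :
    Wrap i.succ (cons k a) (cons k b) :=
  wrap_succ_iff.2 ⟨rfl, h⟩

end GridIndex

/-! ### Slicing is an equivalence of categories -/

namespace CommutingSystem

open GridIndex

variable {A : Type u} [Category.{v} A] [Abelian A] {n : ℕ} {D : CommutingSystem A (Fin (n + 1))}
  {m : ℕ} {p : Fin n → ℕ}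

section

variable (M : RootDiagram (D.liftη p) m)

lemma unsliceGrid_step_zero {k l : Fin (m + 1)} (hkl : k ≤ l) {a : GridIndex p}
    (h : Step 0 (cons k a) (cons l a)) :
    (unsliceGrid M).step h = (M.map hkl).app a :=
  Category.comp_id _

lemma unsliceGrid_step_succ {k : Fin (m + 1)} {i : Fin n} {a b : GridIndex p} (h : Step i a b)
    (h' : Step i.succ (cons k a) (cons k b)) :
    (unsliceGrid M).step h' = (M.obj k).step h :=
  (congrArg ((M.obj k).step h ≫ ·) (map_app_self M le_rfl b)).trans (Category.comp_id _)

lemma unsliceGrid_wrap_zero {a : GridIndex p} (h : Wrap 0 (cons (Fin.last m) a) (cons 0 a)) :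
    (unsliceGrid M).wrap h = M.wrap.app a := by
  have h1 : (D.F 0).map ((M.map (Fin.le_last (Fin.last m))).app a) ≫
      M.wrap.app a ≫ (M.map (Fin.zero_le 0)).app a ≫ 𝟙 _ = M.wrap.app a := by
    rw [map_app_self, map_app_self, CategoryTheory.Functor.map_id, Category.comp_id,
      Category.id_comp, Category.comp_id]
  exact h1

lemma unsliceGrid_wrap_succ {k : Fin (m + 1)} {i : Fin n} {a b : GridIndex p} (h : Wrap i a b)
    (h' : Wrap i.succ (cons k a) (cons k b)) :
    (unsliceGrid M).wrap h' = (M.obj k).wrap h :=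
  (congrArg ((M.obj k).wrap h ≫ ·) (map_app_self M le_rfl b)).trans (Category.comp_id _)

end

lemma naturality_app {M N : RootDiagram (D.liftη p) m} (f : M ⟶ N) {k l : Fin (m + 1)}
    (h : k ≤ l) (a : GridIndex p) :
    (M.map h).app a ≫ (f.app l).app a = (f.app k).app a ≫ (N.map h).app a :=
  congrArg (fun f => PreGrid.Hom.app f a) (f.naturality h)

lemma wrap_app {M N : RootDiagram (D.liftη p) m} (f : M ⟶ N) (a : GridIndex p) :
    M.wrap.app a ≫ (f.app 0).app a = (D.F 0).map ((f.app (Fin.last m)).app a) ≫ N.wrap.app a :=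
  congrArg (fun f => PreGrid.Hom.app f a) f.wrap

variable (D m p) in
/-- Diagrams of root objects for the last functors, as root objects for all functors. -/
@[reducible]
def unslice : RootDiagram (D.liftη p) m ⥤ D.Root (consShape m p) where
  obj M := unsliceObj M
  map {M N} f :=
    { app a := (f.app (head a)).app (others a)
      step {i a b} h := by
        cases i using Fin.cases with
        | zero =>
          change (_ ≫ _) ≫ _ = _ ≫ _ ≫ _
          rw [Category.assoc, Root.eqToHom_app (f.app (head b)) (step_zero_iff.1 h).2,
            reassoc_of% naturality_app f]
        | succ i =>
          change (_ ≫ _) ≫ _ = _ ≫ _ ≫ _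
          rw [Category.assoc, naturality_app f, reassoc_of% (f.app (head a)).step]
      wrap {i a b} h := by
        cases i using Fin.cases with
        | zero =>
          change (_ ≫ _ ≫ _ ≫ _) ≫ _ = _ ≫ _ ≫ _ ≫ _ ≫ _
          simp only [Category.assoc]
          rw [Root.eqToHom_app (f.app (head b)) (wrap_zero_iff.1 h).2.2,
            reassoc_of% naturality_app f, reassoc_of% wrap_app f, ← Functor.map_comp_assoc,
            naturality_app f, Functor.map_comp_assoc]
        | succ i =>
          change (_ ≫ _) ≫ _ = _ ≫ _ ≫ _
          rw [Category.assoc, naturality_app f, reassoc_of% (f.app (head a)).wrap] }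

instance : (unslice D m p).Faithful where
  map_injective {M N f g} h := by
    ext k a
    exact congrArg (fun f => PreGrid.Hom.app f (cons k a)) h

instance : (unslice D m p).Full where
  map_surjective {M N} φ := by
    let f (k : Fin (m + 1)) : M.obj k ⟶ N.obj k :=
      { app a := φ.app (cons k a)
        step {i a b} h := by
          have h1 := φ.step (step_cons_succ k h)
          rw [unsliceGrid_step_succ M h, unsliceGrid_step_succ N h] at h1
          exact h1
        wrap {i a b} h := by
          have h1 := φ.wrap (wrap_cons_succ k h)
          rw [unsliceGrid_wrap_succ M h, unsliceGrid_wrap_succ N h] at h1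
          exact h1 }
    refine ⟨{ app := f
              naturality := RootDiagram.naturality_of_castSucc_le_succ f fun k => ?_
              wrap := ?_ }, ?_⟩
    · ext a
      have h1 := φ.step (step_cons_zero k a)
      rw [unsliceGrid_step_zero M k.castSucc_le_succ, unsliceGrid_step_zero N k.castSucc_le_succ]
        at h1
      exact h1
    · ext a
      have h1 := φ.wrap (wrap_cons_zero a)
      rw [unsliceGrid_wrap_zero M, unsliceGrid_wrap_zero N] at h1
      exact h1
    · ext a
      obtain ⟨k, a, rfl⟩ := exists_cons a
      rfl

section Slice

variable (X : D.Root (consShape m p))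

/-- The slice of a grid at a value of the first coordinate. -/
@[reducible]
def sliceGrid (X : D.PreGrid (consShape m p)) (k : Fin (m + 1)) : D.tail.PreGrid p where
  obj a := X.obj (cons k a)
  step h := X.step (step_cons_succ k h)
  wrap h := X.wrap (wrap_cons_succ k h)

lemma isPath_of_sliceGrid {X : D.PreGrid (consShape m p)} {k : Fin (m + 1)} {i : Fin n}
    {a b : GridIndex p} {u : (sliceGrid X k).obj a ⟶ (sliceGrid X k).obj b}
    (hu : IsPath (sliceGrid X k) i a b u) : IsPath X i.succ (cons k a) (cons k b) u := by
  induction hu with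
  | refl => exact .refl
  | step _ h ih => exact .step ih (step_cons_succ k h)

/-- The slice of a root object at a value of the first coordinate. -/
@[reducible]
def slice (k : Fin (m + 1)) : D.tail.Root p where
  toPreGrid := sliceGrid X.toPreGrid k
  step_step _ _ _ _ := X.step_step _ _ _ _
  wrap_step _ _ _ _ := X.wrap_step _ _ _ _
  wrap_wrap _ _ _ _ := X.wrap_wrap _ _ _ _
  cycle hu h hw := X.cycle (isPath_of_sliceGrid hu) (wrap_cons_succ k h) (isPath_of_sliceGrid hw)

/-- The morphism between consecutive slices. -/
@[reducible]
def sliceMap (k : Fin m) : slice X k.castSucc ⟶ slice X k.succ where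
  app a := X.step (step_cons_zero k a)
  step _ := X.step_step _ _ _ _
  wrap _ := X.wrap_step _ _ _ _

/-- The sequence of slices. -/
noncomputable def sliceFunctor : ComposableArrows (D.tail.Root p) m :=
  ComposableArrows.mkOfObjOfMapSucc (slice X) (sliceMap X)

/-- The morphism from a slice to a later one. -/
noncomputable def sliceMapLE {k l : Fin (m + 1)} (h : k ≤ l) : slice X k ⟶ slice X l :=
  (sliceFunctor X).map (homOfLE h)

lemma sliceMapLE_self {k : Fin (m + 1)} (h : k ≤ k) : sliceMapLE X h = 𝟙 _ :=
  (sliceFunctor X).map_id k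

lemma sliceMapLE_comp {k l r : Fin (m + 1)} (h : k ≤ l) (h' : l ≤ r) :
    sliceMapLE X h ≫ sliceMapLE X h' = sliceMapLE X (h.trans h') :=
  ((sliceFunctor X).map_comp (homOfLE h) (homOfLE h')).symm

lemma sliceMapLE_castSucc_le_succ (k : Fin m) : sliceMapLE X k.castSucc_le_succ = sliceMap X k :=
  ComposableArrows.mkOfObjOfMapSucc_map_succ (slice X) (sliceMap X) k.val k.isLt

/-- The law `cycle` speaks of composites of single steps; this lets it be applied to the transition
maps between slices. -/
lemma isPath_sliceMapLE {k l : Fin (m + 1)} (h : k ≤ l) (a : GridIndex p) :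
    IsPath X.toPreGrid 0 (cons k a) (cons l a) ((sliceMapLE X h).app a) := by
  induction l using Fin.induction with
  | zero =>
    obtain rfl := le_antisymm h (Fin.zero_le k)
    rw [sliceMapLE_self]
    exact .refl
  | succ l ih =>
    obtain rfl | h' := eq_or_lt_of_le h
    · rw [sliceMapLE_self]
      exact .refl
    · have h' : k ≤ l.castSucc := Fin.le_castSucc_iff.2 h'
      rw [← sliceMapLE_comp X h' l.castSucc_le_succ, sliceMapLE_castSucc_le_succ]
      exact .step (ih h') (step_cons_zero l a)

/-- The diagram of slices of a root object. -/
@[reducible]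
noncomputable def slices : RootDiagram (D.liftη p) m where
  obj := slice X
  map h := sliceMapLE X h
  map_self h := sliceMapLE_self X h
  map_map h h' := sliceMapLE_comp X h h'
  wrap :=
    { app a := X.wrap (wrap_cons_zero a)
      step h := (X.wrap_step _ _ _ _).symm
      wrap h := by
        dsimp only
        rw [Category.assoc]
        exact (X.wrap_wrap _ _ _ _).symm }
  cycle k := by
    ext a
    exact X.cycle (isPath_sliceMapLE X (Fin.le_last k) a) (wrap_cons_zero a)
      (isPath_sliceMapLE X (Fin.zero_le k) a)

/-- A root object is recovered from its slices. -/
noncomputable def unsliceSlices : unsliceObj (slices X) ≅ X :=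
  Root.isoMk
    { app a := eqToHom (congrArg X.obj (cons_head_others a))
      step {i a b} h := by
        obtain ⟨k, a, rfl⟩ := exists_cons a
        obtain ⟨l, b, rfl⟩ := exists_cons b
        refine (Category.comp_id _).trans (Eq.trans ?_ (Category.id_comp _).symm)
        cases i using Fin.cases with
        | zero =>
          obtain ⟨h1, rfl : a = b⟩ := step_zero_iff.1 h
          have hk : k.val < m := by
            have h2 : l.val = k.val + 1 := h1
            omega
          obtain ⟨k, rfl⟩ : ∃ k' : Fin m, k = k'.castSucc := ⟨⟨k, hk⟩, rfl⟩
          obtain rfl : l = k.succ := Fin.ext h1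
          exact (unsliceGrid_step_zero _ k.castSucc_le_succ h).trans
            (congrArg (fun f => PreGrid.Hom.app f a) (sliceMapLE_castSucc_le_succ X k))
        | succ i =>
          obtain ⟨rfl : k = l, h1⟩ := step_succ_iff.1 h
          exact unsliceGrid_step_succ _ h1 h
      wrap {i a b} h := by
        obtain ⟨k, a, rfl⟩ := exists_cons a
        obtain ⟨l, b, rfl⟩ := exists_cons b
        refine (Category.comp_id _).trans
          (Eq.trans ?_ ((congrArg (· ≫ _) ((D.F i).map_id _)).trans (Category.id_comp _)).symm)
        cases i using Fin.cases with
        | zero =>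
          obtain ⟨rfl : k = Fin.last m, rfl : l = 0, rfl : a = b⟩ := wrap_zero_iff.1 h
          exact unsliceGrid_wrap_zero _ h
        | succ i =>
          obtain ⟨rfl : k = l, h1⟩ := wrap_succ_iff.1 h
          exact unsliceGrid_wrap_succ _ h1 h }
    (fun a => eqToIso (congrArg X.obj (cons_head_others a))) (fun _ => rfl)

end Slice

instance : (unslice D m p).EssSurj where
  mem_essImage X := ⟨slices X, ⟨unsliceSlices X⟩⟩

instance : (unslice D m p).IsEquivalence where

end CommutingSystem

/-! ### The transported abelian structure, and covers of root objects -/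

namespace CommutingSystem

open GridIndex

variable {A : Type u} [Category.{v} A] [Abelian A]

section Slice

variable {n : ℕ} (D : CommutingSystem A (Fin (n + 1))) (m : ℕ) (p : Fin n → ℕ)

noncomputable instance : Preadditive (RootDiagram (D.liftη p) m) :=
  .ofFullyFaithful (Functor.FullyFaithful.ofFullyFaithful (unslice D m p))

noncomputable instance : HasFiniteProducts (RootDiagram (D.liftη p) m) where
  out _ := Adjunction.hasLimitsOfShape_of_equivalence (unslice D m p)

noncomputable instance : Abelian (RootDiagram (D.liftη p) m) :=
  abelianOfEquivalence (unslice D m p)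

/-- Evaluating at `k` and then at `a` is the same as unslicing and then evaluating at `cons k a`,
which is exact. -/
lemma ev_exact (k : Fin (m + 1)) : PreservesFiniteLimits (RootDiagram.ev (D.liftη p) m k) ∧
    PreservesFiniteColimits (RootDiagram.ev (D.liftη p) m k) :=
  Root.exact_of_comp_ev _
    (fun a => inferInstanceAs (PreservesFiniteLimits (unslice D m p ⋙ Root.ev D _ (cons k a))))
    (fun a => inferInstanceAs (PreservesFiniteColimits (unslice D m p ⋙ Root.ev D _ (cons k a))))

instance (k : Fin (m + 1)) : PreservesFiniteLimits (RootDiagram.ev (D.liftη p) m k) :=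
  (D.ev_exact m p k).1

instance (k : Fin (m + 1)) : PreservesFiniteColimits (RootDiagram.ev (D.liftη p) m k) :=
  (D.ev_exact m p k).2

end Slice

section Cover

lemma ev_faithful_full_essSurj (D : CommutingSystem A (Fin 0)) (p : Fin 0 → ℕ) (a : GridIndex p) :
    (Root.ev D p a).Faithful ∧ (Root.ev D p a).Full ∧ (Root.ev D p a).EssSurj := by
  refine ⟨⟨fun {X Y f g} h => ?_⟩, ⟨fun {X Y} f => ?_⟩, ⟨fun X => ?_⟩⟩
  · ext b
    obtain rfl : a = b := Subsingleton.elim _ _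
    exact h
  · refine ⟨{ app b := eqToHom (congrArg X.obj (Subsingleton.elim b a)) ≫ f ≫
                eqToHom (congrArg Y.obj (Subsingleton.elim a b))
              step {i} := i.elim0
              wrap {i} := i.elim0 }, ?_⟩
    simp
  · exact ⟨{ obj _ := X
             step {i} := i.elim0
             wrap {i} := i.elim0
             step_step {i} := i.elim0
             wrap_step {i} := i.elim0
             wrap_wrap {i} := i.elim0
             cycle {i} := i.elim0 }, ⟨Iso.refl _⟩⟩

lemma ev_isEquivalence (D : CommutingSystem A (Fin 0)) (p : Fin 0 → ℕ) (a : GridIndex p) :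
    (Root.ev D p a).IsEquivalence :=
  have h := ev_faithful_full_essSurj D p a
  { faithful := h.1, full := h.2.1, essSurj := h.2.2 }

/-- Induction on the number of functors: for none, a root object is an object of `A`; otherwise the
one-variable cover is applied over the slices, to the class of root objects with all components in
`W`. -/
lemma Root.exists_cover (W : ObjectProperty A) [W.IsClosedUnderIsomorphisms] (hW0 : W 0)
    (hW : ∀ X Y, W X → W Y → W (X ⊞ Y)) (hQ : ∀ X : A, ∃ (Q : A) (q : Q ⟶ X), W Q ∧ Epi q)
    {n : ℕ} (D : CommutingSystem A (Fin n)) (p : Fin n → ℕ) (hp : ∀ i, 0 < p i)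
    (hF : ∀ i X, W X → W ((D.F i).obj X))
    (hη : ∀ i X, (D.F i).map ((D.η i).app X) = (D.η i).app ((D.F i).obj X)) (X : D.Root p) :
    ∃ (M : D.Root p) (q : M ⟶ X), (∀ a, W (M.obj a)) ∧ Epi q := by
  induction n with
  | zero =>
    let a : GridIndex p := fun i => i.elim0
    have := ev_isEquivalence D p a
    obtain ⟨Q, q, h1, h2⟩ := hQ (X.obj a)
    let e := (Root.ev D p a).objObjPreimageIso Q
    refine ⟨(Root.ev D p a).objPreimage Q, (Root.ev D p a).preimage (e.hom ≫ q), fun b => ?_, ?_⟩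
    · obtain rfl : a = b := Subsingleton.elim _ _
      exact W.prop_of_iso e.symm h1
    · apply (Root.ev D p a).epi_of_epi_map
      rw [Functor.map_preimage]
      exact epi_comp _ _
  | succ n ih =>
    obtain ⟨m, p, rfl⟩ : ∃ (m : ℕ) (p' : Fin n → ℕ), p = consShape m p' :=
      ⟨p 0 - 1, fun i => p i.succ, by
        rw [consShape, Nat.sub_add_cancel (hp 0)]
        exact (Fin.cons_self_tail p).symm⟩
    let W' : ObjectProperty (D.tail.Root p) := fun X => ∀ a, W (X.obj a)
    have : W'.IsClosedUnderIsomorphisms :=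
      ⟨fun e h a => W.prop_of_iso ((Root.ev D.tail p a).mapIso e) (h a)⟩
    obtain ⟨M, q, h1, h2⟩ := RootDiagram.exists_cover (η := D.liftη p) W'
      (fun a => W.prop_of_iso (((Root.ev D.tail p a).map_isZero (isZero_zero _)).isoZero).symm hW0)
      (fun X Y hX hY a => by
        have : PreservesBinaryBiproducts (Root.ev D.tail p a) :=
          preservesBinaryBiproducts_of_preservesBinaryProducts _
        exact W.prop_of_iso ((Root.ev D.tail p a).mapBiprod X Y).symm (hW _ _ (hX a) (hY a)))
      (fun X hX a => hF 0 _ (hX a))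
      (fun X => Root.hom_ext fun a => hη 0 _)
      (ih D.tail p (fun i => hp i.succ) (fun i => hF i.succ) (fun i => hη i.succ)) (slices X)
    refine ⟨(unslice D m p).obj M, (unslice D m p).map q ≫ (unsliceSlices X).hom,
      fun a => h1 _ _, ?_⟩
    have : Epi ((unslice D m p).map q) := (unslice D m p).map_epi q
    exact epi_comp _ _

end Cover

/-! ### Root objects with components in a full subcategory -/

section Restrict

variable {ι : Type} {D : CommutingSystem A ι} {P : ObjectProperty A} [P.ContainsZero]
  [P.IsClosedUnderSubobjects] [P.IsClosedUnderQuotients] [P.IsClosedUnderFiniteProducts]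
  {hP : ∀ i X, P X → P ((D.F i).obj X)} {p : ι → ℕ}

/-- A grid in a full subcategory, as a grid in the ambient category. -/
@[reducible]
def forgetGrid (X : (D.restrict hP).PreGrid p) : D.PreGrid p where
  obj a := (X.obj a).obj
  step h := (X.step h).hom
  wrap h := (X.wrap h).hom

lemma exists_isPath_of_forgetGrid {X : (D.restrict hP).PreGrid p} {i : ι} {a b : GridIndex p}
    {u : (forgetGrid X).obj a ⟶ (forgetGrid X).obj b} (hu : IsPath (forgetGrid X) i a b u) :
    ∃ u', IsPath X i a b u' ∧ u = u'.hom := by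
  induction hu with
  | refl => exact ⟨_, .refl, rfl⟩
  | step _ h ih =>
    obtain ⟨u', h1, rfl⟩ := ih
    exact ⟨_, .step h1 h, rfl⟩

lemma isPath_forgetGrid {X : (D.restrict hP).PreGrid p} {i : ι} {a b : GridIndex p}
    {u : X.obj a ⟶ X.obj b} (hu : IsPath X i a b u) : IsPath (forgetGrid X) i a b u.hom := by
  induction hu with
  | refl => exact .refl
  | step _ h ih => exact .step ih h

variable (hP p) in
/-- Root objects in a full subcategory, as root objects in the ambient category. -/
@[reducible]
def forgetRestrict : (D.restrict hP).Root p ⥤ D.Root p where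
  obj X :=
    { toPreGrid := forgetGrid X.toPreGrid
      step_step h₁ h₂ h₃ h₄ := congrArg (·.hom) (X.step_step h₁ h₂ h₃ h₄)
      wrap_step h₁ h₂ h₃ h₄ := congrArg (·.hom) (X.wrap_step h₁ h₂ h₃ h₄)
      wrap_wrap h₁ h₂ h₃ h₄ := congrArg (·.hom) (X.wrap_wrap h₁ h₂ h₃ h₄)
      cycle hu h hw := by
        obtain ⟨u, hu', rfl⟩ := exists_isPath_of_forgetGrid hu
        obtain ⟨w, hw', rfl⟩ := exists_isPath_of_forgetGrid hw
        exact congrArg (·.hom) (X.cycle hu' h hw') }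
  map f :=
    { app a := (f.app a).hom
      step h := congrArg (·.hom) (f.step h)
      wrap h := congrArg (·.hom) (f.wrap h) }

instance : (forgetRestrict hP p).Faithful where
  map_injective {X Y f g} h := by
    ext a
    exact congrArg (fun f => PreGrid.Hom.app f a) h

instance : (forgetRestrict hP p).Full where
  map_surjective f :=
    ⟨{ app a := ObjectProperty.homMk (f.app a)
       step h := by ext; exact f.step h
       wrap h := by ext; exact f.wrap h }, rfl⟩

variable (hP p) in
/-- Root objects whose components lie in a full subcategory are root objects in it. -/
noncomputable def restrictEquivalence (Q : ObjectProperty (D.Root p))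
    (hQ : ∀ X, Q X ↔ ∀ a, P (X.obj a)) : (D.restrict hP).Root p ≌ Q.FullSubcategory :=
  have : (Q.lift (forgetRestrict hP p) fun X => (hQ _).2 fun a => (X.obj a).property).EssSurj :=
    ⟨fun X => by
      let Z : (D.restrict hP).PreGrid p :=
        { obj a := ⟨X.obj.obj a, (hQ _).1 X.property a⟩
          step h := ObjectProperty.homMk (X.obj.step h)
          wrap h := ObjectProperty.homMk (X.obj.wrap h) }
      exact ⟨{ toPreGrid := Z
               step_step _ _ _ _ := by ext; exact X.obj.step_step _ _ _ _
               wrap_step _ _ _ _ := by ext; exact X.obj.wrap_step _ _ _ _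
               wrap_wrap _ _ _ _ := by ext; exact X.obj.wrap_wrap _ _ _ _
               cycle hu h hw := by
                ext
                exact X.obj.cycle (isPath_forgetGrid hu) h (isPath_forgetGrid hw) },
        ⟨Iso.refl _⟩⟩⟩
  have : (Q.lift (forgetRestrict hP p) fun X =>
    (hQ _).2 fun a => (X.obj a).property).IsEquivalence := { }
  (Q.lift (forgetRestrict hP p) fun X => (hQ _).2 fun a => (X.obj a).property).asEquivalence

end Restrict

end CommutingSystem

/-- A full subcategory of a full subcategory is a full subcategory. -/
noncomputable def CategoryTheory.ObjectProperty.fullSubcategoryFullSubcategoryEquivalence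
    {C : Type u} [Category.{v} C] {P : ObjectProperty C} (Q : ObjectProperty P.FullSubcategory)
    (R : ObjectProperty C) (hR : ∀ X : P.FullSubcategory, Q X → R X.obj)
    (hR' : ∀ X, R X → ∃ hX : P X, Q ⟨X, hX⟩) : Q.FullSubcategory ≌ R.FullSubcategory :=
  have : (R.lift (Q.ι ⋙ P.ι) fun X => hR _ X.property).EssSurj :=
    ⟨fun X => by
      obtain ⟨h1, h2⟩ := hR' _ X.property
      exact ⟨⟨⟨X.obj, h1⟩, h2⟩, ⟨Iso.refl _⟩⟩⟩
  have : (R.lift (Q.ι ⋙ P.ι) fun X => hR _ X.property).IsEquivalence := { }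
  (R.lift (Q.ι ⋙ P.ι) fun X => hR _ X.property).asEquivalence

lemma globalDimensionLT_fullSubcategory_congr {C : Type u} [Category.{v} C] [Abelian C]
    {P Q : ObjectProperty C} [P.ContainsZero] [P.IsClosedUnderKernels] [P.IsClosedUnderCokernels]
    [P.IsClosedUnderFiniteProducts] [Q.ContainsZero] [Q.IsClosedUnderKernels]
    [Q.IsClosedUnderCokernels] [Q.IsClosedUnderFiniteProducts] (h : P = Q) (N : ℕ) :
    GlobalDimensionLT P.FullSubcategory N ↔ GlobalDimensionLT Q.FullSubcategory N := by
  subst h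
  rfl

/-! ### The induction on the number of functors -/

namespace CommutingSystem

open GridIndex

variable {A : Type u} [Category.{v} A] [Abelian A]

section

variable {n : ℕ} (D : CommutingSystem A (Fin (n + 1)))

lemma map_η_zero (j : Fin n) (X : A) : (D.F j.succ).map ((D.η 0).app X) =
    (D.comm 0 j.succ).hom.app X ≫ (D.η 0).app ((D.F j.succ).obj X) :=
  D.η_comm 0 j.succ (Fin.succ_ne_zero j).symm X

lemma zeroLocus_map (j : Fin n) (X : A) (hX : RootDiagram.zeroLocus (D.η 0) X) :
    RootDiagram.zeroLocus (D.η 0) ((D.F j.succ).obj X) := by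
  change (D.η 0).app _ = 0
  rw [← cancel_epi ((D.comm 0 j.succ).hom.app X), comp_zero, ← map_η_zero,
    show (D.η 0).app X = 0 from hX, Functor.map_zero]

/-- Up to the commutation isomorphism `η 0` at `F j X` is `F j (η 0 X)`, and `F j` is left exact. -/
lemma monoLocus_map (j : Fin n) (X : A) (hX : monoLocus (D.η 0) X) :
    monoLocus (D.η 0) ((D.F j.succ).obj X) := by
  have : Mono ((D.η 0).app X) := hX
  have h : (D.η 0).app ((D.F j.succ).obj X) =
      (D.comm j.succ 0).hom.app X ≫ (D.F j.succ).map ((D.η 0).app X) := by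
    rw [map_η_zero, reassoc_of% D.comm_symm j.succ 0]
  change Mono _
  rw [h]
  infer_instance

/-- The restriction of the last functors to the objects `X` with `η 0 X = 0`. -/
abbrev restrictTail : CommutingSystem (RootDiagram.zeroLocus (D.η 0)).FullSubcategory (Fin n) :=
  D.tail.restrict D.zeroLocus_map

instance [∀ i, (D.F i).Faithful] (i : Fin n) : (D.restrictTail.F i).Faithful where
  map_injective h := by
    ext
    exact (D.F i.succ).map_injective (congrArg (·.hom) h)

lemma tail_vanishing (I : Finset (Fin n)) :
    D.tail.vanishing I = D.vanishing (I.map (Fin.succEmb n)) := by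
  ext X
  simp [vanishing]

lemma vanishing_cons_iff (I : Finset (Fin n)) (X : A) :
    D.vanishing (insert 0 (I.map (Fin.succEmb n))) X ↔
      RootDiagram.zeroLocus (D.η 0) X ∧ D.tail.vanishing I X := by
  simp [vanishing, RootDiagram.zeroLocus]

lemma restrictTail_vanishing_iff (I : Finset (Fin n))
    (X : (RootDiagram.zeroLocus (D.η 0)).FullSubcategory) :
    D.restrictTail.vanishing I X ↔ D.tail.vanishing I X.obj :=
  ⟨fun h i hi => congrArg (·.hom) (h i hi), fun h i hi => by ext; exact h i hi⟩

/-- The vanishing subcategories for the restricted system. -/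
noncomputable def vanishingSubRestrictTail (I : Finset (Fin n)) :
    D.restrictTail.VanishingSub I ≌ D.VanishingSub (insert 0 (I.map (Fin.succEmb n))) :=
  ObjectProperty.fullSubcategoryFullSubcategoryEquivalence _ _
    (fun X hX => (D.vanishing_cons_iff I _).2 ⟨X.property, (D.restrictTail_vanishing_iff I X).1 hX⟩)
    (fun X hX =>
      have h := (D.vanishing_cons_iff I X).1 hX
      ⟨h.1, (D.restrictTail_vanishing_iff I ⟨X, h.1⟩).2 h.2⟩)

variable {D}

lemma EnoughMono.exists_epi {n : ℕ} {D : CommutingSystem A (Fin n)} (hD : D.EnoughMono) (i : Fin n)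
    (X : A) : ∃ (Q : A) (q : Q ⟶ X), monoLocus (D.η i) Q ∧ Epi q := by
  obtain ⟨Q, q, -, h1, h2⟩ := hD ∅ i (Finset.notMem_empty i) X (by simp [vanishing])
  exact ⟨Q, q, h2, h1⟩

lemma EnoughMono.tail (hD : D.EnoughMono) : D.tail.EnoughMono := by
  intro I i hi X hX
  rw [tail_vanishing] at hX ⊢
  exact hD _ i.succ (by simpa using hi) X hX

/-- The condition for `I` in the restricted system is the original one for `I` together with `0`;
this is why covers are required inside every `A_I`. -/
lemma EnoughMono.restrictTail (hD : D.EnoughMono) : D.restrictTail.EnoughMono := by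
  intro I i hi X hX
  have h : D.vanishing (insert 0 (I.map (Fin.succEmb n))) X.obj :=
    (D.vanishing_cons_iff I _).2 ⟨X.property, (D.restrictTail_vanishing_iff I X).1 hX⟩
  obtain ⟨M, q, h1, h2, h3⟩ := hD _ i.succ (by simpa using hi) X.obj h
  rw [vanishing_cons_iff] at h1
  refine ⟨⟨M, h1.1⟩, ObjectProperty.homMk q, (D.restrictTail_vanishing_iff I _).2 h1.2, ?_, ?_⟩
  · exact (RootDiagram.zeroLocus (D.η 0)).ι.epi_of_epi_map h2
  · exact (RootDiagram.zeroLocus (D.η 0)).ι.mono_of_mono_map h3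

/-- The one-variable theorem over `D.tail.Root p`. Its zero locus consists of the root objects whose
components are killed by `η 0`, and its covers by objects with mono `η` are built componentwise by
`Root.exists_cover`. -/
lemma globalDimensionLT_root_cons_iff (hD : D.EnoughMono) [∀ i, (D.F i).Faithful] (m : ℕ)
    (p : Fin n → ℕ) (hp : ∀ i, 0 < p i) (N : ℕ) :
    GlobalDimensionLT (D.Root (consShape (m + 1) p)) N ↔ GlobalDimensionLT (D.tail.Root p) N ∧
      GlobalDimensionLT (D.restrictTail.Root p) (N - 1) := by
  rw [← globalDimensionLT_iff_of_equivalence (unslice D (m + 1) p).asEquivalence,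
    RootDiagram.globalDimensionLT_iff,
    globalDimensionLT_iff_of_equivalence (restrictEquivalence D.zeroLocus_map p
      (RootDiagram.zeroLocus (D.liftη p)) fun X => ?_)]
  · exact ⟨fun h a => congrArg (fun f => PreGrid.Hom.app f a) h, fun h => Root.hom_ext h⟩
  · intro X
    have (i : Fin (n + 1)) (X : A) :=
      map_app_eq (D.η i) (hD.exists_epi i) X
    obtain ⟨Q, q, h1, h2⟩ := Root.exists_cover (monoLocus (D.η 0))
      (show Mono _ from ⟨fun _ _ _ => ((D.F 0).map_isZero (isZero_zero A)).eq_of_tgt _ _⟩)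
      (fun _ _ => monoLocus_biprod (D.η 0)) (hD.exists_epi 0) D.tail p hp D.monoLocus_map
      (fun i => this i.succ) X
    exact ⟨Q, q, Root.mono_of_app _ h1, h2⟩

end

lemma globalDimensionLT_root_iff {n : ℕ} (D : CommutingSystem A (Fin n)) (p : Fin n → ℕ)
    (hp : ∀ i, 2 ≤ p i) (hD : D.EnoughMono) [hF : ∀ i, (D.F i).Faithful] (N : ℕ) :
    GlobalDimensionLT (D.Root p) N ↔
      ∀ I : Finset (Fin n), GlobalDimensionLT (D.VanishingSub I) (N - I.card) := by
  induction n generalizing A N with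
  | zero =>
    have := ev_isEquivalence D p (fun i => i.elim0)
    have e : D.VanishingSub ∅ ≌ A :=
      have : (D.vanishing ∅).ι.EssSurj := ⟨fun X => ⟨⟨X, by simp [vanishing]⟩, ⟨Iso.refl _⟩⟩⟩
      have : (D.vanishing ∅).ι.IsEquivalence := { }
      (D.vanishing ∅).ι.asEquivalence
    rw [globalDimensionLT_iff_of_equivalence (Root.ev D p fun i => i.elim0).asEquivalence,
      ← globalDimensionLT_iff_of_equivalence e]
    refine ⟨fun h I => ?_, fun h => h ∅⟩
    obtain rfl : I = ∅ := Subsingleton.elim _ _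
    exact h
  | succ n ih =>
    -- Here `2 ≤ p 0` enters: the first coordinate takes `m + 2` values with `m = p 0 - 2`.
    obtain ⟨m, p, rfl⟩ : ∃ (m : ℕ) (p' : Fin n → ℕ), p = consShape (m + 1) p' :=
      ⟨p 0 - 2, fun i => p i.succ, by
        rw [consShape, show p 0 - 2 + 1 + 1 = p 0 from Nat.sub_add_cancel (hp 0)]
        exact (Fin.cons_self_tail p).symm⟩
    have hp' (i : Fin n) : 2 ≤ p i := hp i.succ
    rw [globalDimensionLT_root_cons_iff hD m p (fun i => by have := hp' i; omega) N,
      ih D.tail p hp' hD.tail N, ih D.restrictTail p hp' hD.restrictTail (N - 1)]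
    have h1 (I : Finset (Fin n)) : GlobalDimensionLT (D.tail.VanishingSub I) (N - I.card) ↔
        GlobalDimensionLT (D.VanishingSub (I.map (Fin.succEmb n)))
          (N - (I.map (Fin.succEmb n)).card) := by
      rw [Finset.card_map]
      exact globalDimensionLT_fullSubcategory_congr (D.tail_vanishing I) _
    have h2 (I : Finset (Fin n)) :
        GlobalDimensionLT (D.restrictTail.VanishingSub I) (N - 1 - I.card) ↔
        GlobalDimensionLT (D.VanishingSub (insert 0 (I.map (Fin.succEmb n))))
          (N - (insert 0 (I.map (Fin.succEmb n))).card) := by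
      rw [Finset.card_insert_of_notMem (by simp), Finset.card_map, Nat.sub_sub, add_comm 1]
      exact globalDimensionLT_iff_of_equivalence (D.vanishingSubRestrictTail I) _
    simp only [h1, h2]
    refine ⟨fun h I => ?_, fun h => ⟨fun I => h _, fun I => h _⟩⟩
    have hI (i : Fin n) : i.succ ∈ I ↔
        i.succ ∈ (Finset.univ.filter fun i : Fin n => i.succ ∈ I).map (Fin.succEmb n) := by
      simp
    -- Subsets containing `0` are handled by the restricted system, with `0` contributing the extra
    -- `1` to the cardinality; the others by the tail.
    by_cases h0 : 0 ∈ I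
    · obtain ⟨T, rfl⟩ : ∃ T : Finset (Fin n), I = insert 0 (T.map (Fin.succEmb n)) :=
        ⟨_, by
          ext i
          cases i using Fin.cases with
          | zero => simp [h0]
          | succ i => rw [hI i, Finset.mem_insert, or_iff_right (Fin.succ_ne_zero i)]⟩
      exact h.2 T
    · obtain ⟨T, rfl⟩ : ∃ T : Finset (Fin n), I = T.map (Fin.succEmb n) :=
        ⟨_, by
          ext i
          cases i using Fin.cases with
          | zero => simp [h0]
          | succ i => exact hI i⟩
      exact h.1 T

end CommutingSystem

theorem mainTheorem5 {A : Type u} [Category.{v} A] [Abelian A] {n : ℕ}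
    (D : CommutingSystem A (Fin n)) (p : Fin n → ℕ) (hp : ∀ i, 2 ≤ p i)
    (hD : D.EnoughMono) (hF : ∀ i, (D.F i).IsEquivalence) :
    gldim (D.Root p) =
      Finset.univ.sup fun I : Finset (Fin n) => gldim (D.VanishingSub I) + (I.card : WithBot ℕ∞) := by
  have (i : Fin n) : (D.F i).Faithful := (hF i).faithful
  refine withBot_enat_eq_of_lt_iff fun N => ?_
  rw [gldim_lt_iff, D.globalDimensionLT_root_iff p hp hD N, Finset.sup_lt_iff (WithBot.bot_lt_coe _)]
  simp [withBot_enat_add_lt_iff, gldim_lt_iff]
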